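/- Let $(W,S)$ be a finite Coxeter system of rank $n$ with set of reflections $T$, absolute length $\ell$ (word length with respect to $T$) and absolute order ($v\le w$ iff $\ell(w)=\ell(v)+\ell(v^{-1}w)$). Let $c$ be a Coxeter element (a conjugate of a product of all elements of $S$ in some order), let $\mathrm{NC}=\{w\in W: w\le c\}$ be the poset of non-crossing partitions, and let $c=lr$ with $l^2=r^2=1$. Let $\mathcal D=\langle\varphi_l,\varphi_r\rangle\le\mathrm{Aut}(\mathrm{NC})$, where $\varphi_l(w)=lw^{-1}l$ and $\varphi_r(w)=rw^{-1}r$. Consider either of the following two settings. (1) $\mathbb F=\mathbb R$, $V$ is the space of the geometric representation of $W$ (with the simple roots $\alpha_s$, $s\in S$, of length one as a basis), and $f(w)=\mathrm{mov}(w)=\mathrm{im}(w-\mathrm{id})$. (2) $W$ carries a (reduced) crystallographic root system $\Phi$ with simple roots $\alpha_s$, obtained from the roots of the geometric representation by rescaling; $p$ is a prime compatible with $\Phi$, meaning that every basis of the real space consisting of positive roots, written in coordinates with respect to the simple roots, reduces modulo $p$ to a basis; $\mathbb F=\mathbb F_p$, $V=\mathbb F_p^S$, and $f(w)$ is the reduction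 modulo $p$ of the group of integer vectors (in the simple root coordinates) in $\mathrm{mov}(w)$. For $t\in T$ let $\alpha_t\in V$ denote the root with reflection $t$ (its reduction modulo $p$ in setting (2)), which is determined up to sign. Let $\Lambda(V)$ be the lattice of linear subspaces of $V$, and let $|\mathrm{NC}|$ and $|\Lambda(V)|$ be the order complexes (simplices are chains of elements other than the minimum and the maximum), the type of a vertex being its rank, that is, $\ell(w)$ or $\dim U$ respectively. Then for every $\varphi\in\mathcal D$ the following hold. (a) $\varphi$ induces a type-preserving simplicial automorphism $|\varphi|$ of $|\mathrm{NC}|$. (b) There is a linear automorphism $\psi$ of $V$ with $\psi(\alpha_t)=\pm\alpha_{\varphi(t)}$ for all reflections $t\in\mathrm{NC}$, such that the lattice automorphism $\Psi\colon U\mapsto\psi(U)$ of $\Lambda(V)$ extends $\varphi$, that is, $\Psi\circ f=f\circ\varphi$. (c) $f$ maps vertices of $|\mathrm{NC}|$ to vertices of $|\Lambda(V)|$, and $\Psi$ induces a type-preserving simplicial automorphism of the building $|\Lambda(V)|$ that extends $|\varphi|$ along $f$. (d) If $W$ is irreducible, then $\Psi$ is the only extension of $\varphi$ to a lattice automorphism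 of $\Lambda(V)$ that is induced by a linear automorphism of $V$. (e) If $W$ is irreducible and $n\neq 2$, then $\Psi$ is the only extension of $\varphi$ to a lattice automorphism of $\Lambda(V)$, and the automorphism it induces on $|\Lambda(V)|$ is the only type-preserving simplicial automorphism of $|\Lambda(V)|$ that extends $|\varphi|$. -/

import Mathlib

/-! ### Order complexes and their automorphisms -/

/-- The elements of a bounded poset different from its minimum and its maximum. -/
abbrev ProperPart (P : Type*) [PartialOrder P] [BoundedOrder P] : Type _ :=
  {x : P // x ≠ ⊥ ∧ x ≠ ⊤}

/-- The order complex `|P|`: its vertices are the elements of `P` other than the minimum and the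
maximum, and its simplices are the finite (nonempty) chains of such elements. -/
def orderComplex (P : Type*) [PartialOrder P] [BoundedOrder P] :
    AbstractSimplicialComplex (ProperPart P) where
  faces := {s | s.Nonempty ∧ IsChain (· ≤ ·) (s : Set (ProperPart P))}
  isRelLowerSet_faces := by
    intro s hs
    refine ⟨hs.1, fun t hts ht => ⟨ht, hs.2.mono ?_⟩⟩
    exact_mod_cast hts
  singleton_mem v := by simp

/-- The group of automorphisms of a simplicial complex (bijections of the vertex set mapping
simplices to simplices in both directions) that preserve a given labelling of the vertices. -/
def typePreservingAut {ι : Type*} (K : AbstractSimplicialComplex ι) (type : ι → ℕ) :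
    Subgroup (Equiv.Perm ι) where
  carrier := {θ | (∀ s : Finset ι, s.map θ.toEmbedding ∈ K.faces ↔ s ∈ K.faces) ∧
    ∀ v, type (θ v) = type v}
  one_mem' := by
    refine ⟨fun s => ?_, fun v => rfl⟩
    have : s.map (1 : Equiv.Perm ι).toEmbedding = s := Finset.map_refl
    rw [this]
  mul_mem' := by
    rintro a b ⟨ha, ha'⟩ ⟨hb, hb'⟩
    refine ⟨fun s => ?_, fun v => by rw [Equiv.Perm.mul_apply, ha', hb']⟩
    have : s.map (a * b).toEmbedding = (s.map b.toEmbedding).map a.toEmbedding := by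
      rw [Finset.map_map]
      rfl
    rw [this, ha, hb]
  inv_mem' := by
    rintro a ⟨ha, ha'⟩
    refine ⟨fun s => ?_, fun v => ?_⟩
    · rw [← ha]
      have : (s.map a⁻¹.toEmbedding).map a.toEmbedding = s := by
        rw [Finset.map_map]
        convert Finset.map_refl
        ext v
        exact a.apply_symm_apply v
      rw [this]
    · rw [← ha', ← Equiv.Perm.mul_apply, mul_inv_cancel, Equiv.Perm.one_apply]

/-- The action on the vertices of the order complex of an automorphism of a bounded poset. -/
def properPerm {P : Type*} [PartialOrder P] [BoundedOrder P] (φ : P ≃o P) :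
    Equiv.Perm (ProperPart P) :=
  φ.toEquiv.subtypeEquiv fun x => by simp

/-- The automorphism `Ψ` of `L` extends the automorphism `φ` of `P` along `f : P → L`. -/
def ExtendsAlong {P L : Type*} [PartialOrder P] [PartialOrder L] (f : P → L)
    (φ : P ≃o P) (Ψ : L ≃o L) : Prop :=
  ∀ x, Ψ (f x) = f (φ x)

/-- The vertex map `f` sends vertices of `|P|` to vertices of `|L|`, and the permutation `Θ` of the
vertices of `|L|` extends the permutation `θ` of the vertices of `|P|` along it. -/
def ExtendsAlongSimplicially {P L : Type*} [PartialOrder P] [BoundedOrder P] [PartialOrder L]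
    [BoundedOrder L] (f : P → L) (θ : Equiv.Perm (ProperPart P))
    (Θ : Equiv.Perm (ProperPart L)) : Prop :=
  ∀ x : ProperPart P, ∃ h : f x ≠ ⊥ ∧ f x ≠ ⊤, (Θ ⟨f x, h⟩ : L) = f (θ x)

namespace CoxeterSystem

variable {B : Type*} {W : Type*} [Group W] {M : CoxeterMatrix B} (cs : CoxeterSystem M W)

/-! ### Absolute order and non-crossing partitions -/

/-- The absolute length: the length with respect to the set of all reflections. -/
noncomputable def absLength (w : W) : ℕ :=
  sInf {k | ∃ L : List W, (∀ t ∈ L, cs.IsReflection t) ∧ L.prod = w ∧ L.length = k}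

theorem exists_absLength (w : W) :
    ∃ L : List W, (∀ t ∈ L, cs.IsReflection t) ∧ L.prod = w ∧ L.length = cs.absLength w := by
  have h : {k | ∃ L : List W, (∀ t ∈ L, cs.IsReflection t) ∧ L.prod = w ∧ L.length = k}.Nonempty := by
    obtain ⟨ω, hω⟩ := cs.wordProd_surjective w
    refine ⟨_, ω.map cs.simple, ?_, hω, rfl⟩
    intro t ht
    obtain ⟨i, -, rfl⟩ := List.mem_map.1 ht
    exact cs.isReflection_simple i
  exact Nat.sInf_mem h

theorem absLength_le {w : W} (L : List W) (hL : ∀ t ∈ L, cs.IsReflection t) (hw : L.prod = w) :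
    cs.absLength w ≤ L.length :=
  Nat.sInf_le ⟨L, hL, hw, rfl⟩

theorem absLength_one : cs.absLength 1 = 0 := by
  simpa using cs.absLength_le (w := 1) [] (by simp) (by simp)

theorem eq_one_of_absLength_eq_zero {w : W} (h : cs.absLength w = 0) : w = 1 := by
  obtain ⟨L, -, h2, h3⟩ := cs.exists_absLength w
  rw [h, List.length_eq_zero_iff] at h3
  subst h3
  simpa using h2.symm

theorem absLength_mul_le (v w : W) :
    cs.absLength (v * w) ≤ cs.absLength v + cs.absLength w := by
  obtain ⟨L, h1, h2, h3⟩ := cs.exists_absLength v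
  obtain ⟨L', h1', h2', h3'⟩ := cs.exists_absLength w
  rw [← h3, ← h3', ← List.length_append]
  refine cs.absLength_le _ ?_ (by rw [List.prod_append, h2, h2'])
  intro t ht
  rcases List.mem_append.1 ht with h | h
  exacts [h1 t h, h1' t h]

theorem absLength_conj (g w : W) : cs.absLength (g * w * g⁻¹) = cs.absLength w := by
  have key : ∀ g w : W, cs.absLength (g * w * g⁻¹) ≤ cs.absLength w := by
    intro g w
    obtain ⟨L, h1, h2, h3⟩ := cs.exists_absLength w
    have := cs.absLength_le (w := g * w * g⁻¹) (L.map (MulAut.conj g)) ?_ ?_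
    · rwa [List.length_map, h3] at this
    · intro t ht
      obtain ⟨u, hu, rfl⟩ := List.mem_map.1 ht
      exact (h1 u hu).conj g
    · rw [← map_list_prod, h2, MulAut.conj_apply]
  refine le_antisymm (key g w) ?_
  have := key g⁻¹ (g * w * g⁻¹)
  rwa [show g⁻¹ * (g * w * g⁻¹) * g⁻¹⁻¹ = w by group] at this

theorem absLength_inv (w : W) : cs.absLength w⁻¹ = cs.absLength w := by
  have key : ∀ w : W, cs.absLength w⁻¹ ≤ cs.absLength w := by
    intro w
    obtain ⟨L, h1, h2, h3⟩ := cs.exists_absLength w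
    have := cs.absLength_le (w := w⁻¹) (L.map (·⁻¹)).reverse ?_ ?_
    · rwa [List.length_reverse, List.length_map, h3] at this
    · intro t ht
      obtain ⟨u, hu, rfl⟩ := List.mem_map.1 (List.mem_reverse.1 ht)
      exact (h1 u hu).isReflection_inv
    · rw [← h2, List.prod_inv_reverse]
  refine le_antisymm (key w) ?_
  simpa using key w⁻¹

/-- The absolute order `v ≤ w` on `W`. -/
def AbsLE (v w : W) : Prop :=
  cs.absLength w = cs.absLength v + cs.absLength (v⁻¹ * w)

theorem AbsLE.inv {v w : W} (h : cs.AbsLE v w) : cs.AbsLE v⁻¹ w⁻¹ := by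
  unfold AbsLE at *
  rw [cs.absLength_inv, cs.absLength_inv, h, ← cs.absLength_inv (v⁻¹⁻¹ * w⁻¹),
    ← cs.absLength_conj v (v⁻¹ * w)]
  congr 2
  group

theorem AbsLE.conj {v w : W} (h : cs.AbsLE v w) (g : W) :
    cs.AbsLE (g * v * g⁻¹) (g * w * g⁻¹) := by
  unfold AbsLE at *
  rw [cs.absLength_conj, cs.absLength_conj, h, ← cs.absLength_conj g (v⁻¹ * w)]
  congr 2
  group

/-- The poset `NC(W, c)` of non-crossing partitions: the elements of `W` below `c` in the
absolute order. -/
@[ext]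
structure NC (c : W) where
  val : W
  absLE : cs.AbsLE val c

theorem absLE_refl (w : W) : cs.AbsLE w w := by
  rw [AbsLE, inv_mul_cancel, absLength_one, add_zero]

theorem one_absLE (w : W) : cs.AbsLE 1 w := by
  rw [AbsLE, absLength_one, inv_one, one_mul, zero_add]

theorem AbsLE.trans {u v w : W} (huv : cs.AbsLE u v) (hvw : cs.AbsLE v w) : cs.AbsLE u w := by
  unfold AbsLE at *
  have h1 := cs.absLength_mul_le (u⁻¹ * v) (v⁻¹ * w)
  have h2 := cs.absLength_mul_le u (u⁻¹ * w)
  rw [show u⁻¹ * v * (v⁻¹ * w) = u⁻¹ * w by group] at h1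
  rw [mul_inv_cancel_left] at h2
  omega

theorem AbsLE.antisymm {v w : W} (hvw : cs.AbsLE v w) (hwv : cs.AbsLE w v) : v = w := by
  unfold AbsLE at *
  have h : cs.absLength (v⁻¹ * w) = 0 := by omega
  exact inv_mul_eq_one.1 (cs.eq_one_of_absLength_eq_zero h)

instance (c : W) : PartialOrder (cs.NC c) where
  le v w := cs.AbsLE v.val w.val
  le_refl v := cs.absLE_refl v.val
  le_trans _ _ _ huv hvw := AbsLE.trans cs huv hvw
  le_antisymm _ _ hvw hwv := NC.ext (AbsLE.antisymm cs hvw hwv)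

instance (c : W) : BoundedOrder (cs.NC c) where
  bot := ⟨1, cs.one_absLE c⟩
  bot_le w := cs.one_absLE w.val
  top := ⟨c, cs.absLE_refl c⟩
  le_top w := w.absLE

/-- A Coxeter element: a conjugate of a product of all simple reflections, each taken once, in
some order. -/
def IsCoxeterElement (c : W) : Prop :=
  ∃ ω : List B, ω.Nodup ∧ (∀ i, i ∈ ω) ∧ IsConj (cs.wordProd ω) c

/-- The irreducibility of the Coxeter system: its Coxeter diagram is connected (in particular
nonempty). -/
def _root_.CoxeterMatrix.IsIrreducible {B : Type*} (M : CoxeterMatrix B) : Prop :=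
  (SimpleGraph.fromRel fun i j : B => M i j ≠ 2).Connected

/-! ### The dihedral group of automorphisms -/

/-- The automorphism `w ↦ a w⁻¹ a` of `NC(W, c)`, where `a` is an involution such that
`a c⁻¹ a = c`. -/
def invConjAut {c : W} (a : W) (ha : a * a = 1) (hc : a * c⁻¹ * a = c) : cs.NC c ≃o cs.NC c :=
  have hinv : a⁻¹ = a := inv_eq_of_mul_eq_one_right ha
  have key : ∀ v w : W, cs.AbsLE v w → cs.AbsLE (a * v⁻¹ * a) (a * w⁻¹ * a) := fun v w h => by
    simpa only [hinv] using AbsLE.conj cs (AbsLE.inv cs h) a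
  have invol : ∀ w : W, a * (a * w⁻¹ * a)⁻¹ * a = w := fun w => by
    simp only [mul_inv_rev, hinv, inv_inv, ← mul_assoc, ha, one_mul]
    rw [mul_assoc, ha, mul_one]
  have mem : ∀ w : cs.NC c, cs.AbsLE (a * w.val⁻¹ * a) c := fun w => by
    simpa only [hc] using key _ _ w.absLE
  { toFun := fun w => ⟨a * w.val⁻¹ * a, mem w⟩
    invFun := fun w => ⟨a * w.val⁻¹ * a, mem w⟩
    left_inv := fun w => NC.ext (invol w.val)
    right_inv := fun w => NC.ext (invol w.val)
    map_rel_iff' := fun {v w} => by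
      refine ⟨fun h => ?_, fun h => key _ _ h⟩
      have := key _ _ h
      rwa [Equiv.coe_fn_mk, invol, invol] at this }

/-- `c = l r` is a bipartition of `c`: both `l` and `r` square to the identity. -/
structure IsBipartition (c l r : W) : Prop where
  eq_mul : c = l * r
  left_sq : l * l = 1
  right_sq : r * r = 1

/-- The automorphism `φ_l : w ↦ l w⁻¹ l`. -/
def leftAut {c l r : W} (h : IsBipartition c l r) : cs.NC c ≃o cs.NC c :=
  cs.invConjAut l h.left_sq (by
    rw [h.eq_mul, mul_inv_rev, inv_eq_of_mul_eq_one_right h.left_sq,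
      inv_eq_of_mul_eq_one_right h.right_sq, mul_assoc, mul_assoc, h.left_sq, mul_one])

/-- The automorphism `φ_r : w ↦ r w⁻¹ r`. -/
def rightAut {c l r : W} (h : IsBipartition c l r) : cs.NC c ≃o cs.NC c :=
  cs.invConjAut r h.right_sq (by
    rw [h.eq_mul, mul_inv_rev, inv_eq_of_mul_eq_one_right h.left_sq,
      inv_eq_of_mul_eq_one_right h.right_sq, ← mul_assoc, h.right_sq, one_mul])

/-- The dihedral group `⟨φ_l, φ_r⟩` of automorphisms of `NC(W, c)`. -/
def dihedralAut {c l r : W} (h : IsBipartition c l r) : Subgroup (cs.NC c ≃o cs.NC c) :=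
  Subgroup.closure {cs.leftAut h, cs.rightAut h}

/-! ### The geometric representation, roots and moved spaces -/

section Geometric

variable [Fintype B] [DecidableEq B]

/-- The bilinear form on the space `B → ℝ`, whose standard basis vectors are the simple roots,
when the simple root `α_i` is given the length `c i`:
`(α_i, α_j) = - c_i c_j cos (π / m_ij)`. -/
noncomputable def _root_.CoxeterMatrix.rootForm (M : CoxeterMatrix B) (c : B → Set.Ioi (0 : ℝ)) :
    LinearMap.BilinForm ℝ (B → ℝ) :=
  Matrix.toBilin' (Matrix.of fun i j => -((c i : ℝ) * c j * Real.cos (Real.pi / M i j)))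

/-- The simple roots. -/
def simpleRoot (i : B) : B → ℝ := Pi.single i 1

theorem rootForm_simpleRoot (c : B → Set.Ioi (0 : ℝ)) (i j : B) :
    M.rootForm c (simpleRoot i) (simpleRoot j) = -((c i : ℝ) * c j * Real.cos (Real.pi / M i j)) := by
  simp [CoxeterMatrix.rootForm, simpleRoot, Matrix.toBilin'_single]

theorem rootForm_simpleRoot_self (c : B → Set.Ioi (0 : ℝ)) (i : B) :
    M.rootForm c (simpleRoot i) (simpleRoot i) = (c i : ℝ) ^ 2 := by
  rw [rootForm_simpleRoot, M.diagonal]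
  simp [sq]

/-- The functional `v ↦ 2 (α_i, v) / (α_i, α_i)`. -/
noncomputable def _root_.CoxeterMatrix.simpleCoroot (M : CoxeterMatrix B)
    (c : B → Set.Ioi (0 : ℝ)) (i : B) : Module.Dual ℝ (B → ℝ) :=
  (2 / M.rootForm c (simpleRoot i) (simpleRoot i)) • M.rootForm c (simpleRoot i)

theorem simpleCoroot_simpleRoot (c : B → Set.Ioi (0 : ℝ)) (i j : B) :
    M.simpleCoroot c i (simpleRoot j) = -(2 * (c j / c i) * Real.cos (Real.pi / M i j)) := by
  have hi : (c i : ℝ) ≠ 0 := (c i).2.ne'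
  rw [CoxeterMatrix.simpleCoroot, LinearMap.smul_apply, rootForm_simpleRoot_self,
    rootForm_simpleRoot, smul_eq_mul]
  field_simp

theorem simpleCoroot_self (c : B → Set.Ioi (0 : ℝ)) (i : B) :
    M.simpleCoroot c i (simpleRoot i) = 2 := by
  have hi : (c i : ℝ) ≠ 0 := (c i).2.ne'
  rw [simpleCoroot_simpleRoot, M.diagonal, div_self hi]
  simp

/-- The reflection `v ↦ v - 2 (α_i, v) / (α_i, α_i) α_i`. -/
noncomputable def _root_.CoxeterMatrix.simpleReflection (M : CoxeterMatrix B)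
    (c : B → Set.Ioi (0 : ℝ)) (i : B) : (B → ℝ) ≃ₗ[ℝ] (B → ℝ) :=
  Module.reflection (simpleCoroot_self (M := M) c i)

theorem isLiftable_simpleReflection (c : B → Set.Ioi (0 : ℝ)) :
    M.IsLiftable (M.simpleReflection c) := by
  intro i j
  have hi : (c i : ℝ) ≠ 0 := (c i).2.ne'
  have hj : (c j : ℝ) ≠ 0 := (c j).2.ne'
  rcases eq_or_ne i j with rfl | hij
  · rw [M.diagonal, pow_one]
    ext v : 1
    exact Module.involutive_reflection (simpleCoroot_self (M := M) c i) v
  rcases Nat.eq_zero_or_pos (M i j) with h0 | hpos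
  · rw [h0, pow_zero]
  have h1 : M i j ≠ 1 := M.off_diagonal i j hij
  set m := M i j with hm
  set θ := Real.pi / m with hθ
  have hmθ : (m : ℝ) * θ = Real.pi := by rw [hθ]; field_simp
  have hgx : M.simpleCoroot c j (simpleRoot i) = -(2 * (c i / c j) * Real.cos θ) := by
    rw [simpleCoroot_simpleRoot, M.symmetric j i]
  have hfy : M.simpleCoroot c i (simpleRoot j) = -(2 * (c j / c i) * Real.cos θ) := by
    rw [simpleCoroot_simpleRoot]
  have ht : 2 * Real.cos (2 * θ)
      = M.simpleCoroot c i (simpleRoot j) * M.simpleCoroot c j (simpleRoot i) - 2 := by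
    rw [hgx, hfy, Real.cos_two_mul]
    field_simp
  ext v : 1
  change ((Module.reflection (simpleCoroot_self (M := M) c i) *
    Module.reflection (simpleCoroot_self (M := M) c j)) ^ m) v = v
  rcases eq_or_ne m 2 with h2 | h2
  · have hc0 : Real.cos θ = 0 := by rw [hθ, h2]; simp
    rw [hc0] at hgx hfy
    simp only [mul_zero, neg_zero] at hgx hfy
    rw [h2, sq]
    simp only [LinearEquiv.mul_apply, Module.reflection_apply, map_sub, map_smul, hgx, hfy,
      simpleCoroot_self]
    module
  have hsin : Real.sin (2 * θ) ≠ 0 := by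
    have hm3 : 3 ≤ m := by omega
    have hm3' : (3 : ℝ) ≤ m := by exact_mod_cast hm3
    have hθpos : 0 < θ := div_pos Real.pi_pos (by positivity)
    refine (Real.sin_pos_of_pos_of_lt_pi (by positivity) ?_).ne'
    nlinarith
  have hS : ∀ n : ℤ, (Polynomial.Chebyshev.S ℝ n).eval (2 * Real.cos (2 * θ))
      = Real.sin ((n + 1) * (2 * θ)) / Real.sin (2 * θ) := fun n => by
    rw [eq_div_iff hsin, Polynomial.Chebyshev.S_two_mul_real_cos]
  rw [Module.reflection_mul_reflection_pow_apply _ _ m v _ ht]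
  rcases Nat.even_or_odd' m with ⟨k, hk | hk⟩
  · have e1 : ((m : ℤ) - 2) / 2 = k - 1 := by omega
    have e2 : ((m : ℤ) - 1) / 2 = k - 1 := by omega
    have hz : (Polynomial.Chebyshev.S ℝ ((k : ℤ) - 1)).eval (2 * Real.cos (2 * θ)) = 0 := by
      rw [hS]
      have : (((k : ℤ) - 1 : ℤ) + 1 : ℝ) * (2 * θ) = Real.pi := by
        rw [← hmθ, hk]; push_cast; ring
      rw [this]; simp
    rw [e1, e2, hz]
    simp
  · have e1 : ((m : ℤ) - 2) / 2 = k - 1 := by omega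
    have e2 : ((m : ℤ) - 1) / 2 = k := by omega
    have e3 : ((m : ℤ) - 3) / 2 = k - 1 := by omega
    have e4 : (m : ℤ) / 2 = k := by omega
    have hz : (Polynomial.Chebyshev.S ℝ (k : ℤ)).eval (2 * Real.cos (2 * θ))
        + (Polynomial.Chebyshev.S ℝ ((k : ℤ) - 1)).eval (2 * Real.cos (2 * θ)) = 0 := by
      rw [hS, hS, ← add_div]
      have a1 : (((k : ℤ) : ℝ) + 1) * (2 * θ) = Real.pi + θ := by
        rw [← hmθ, hk]; push_cast; ring
      have a2 : (((k : ℤ) - 1 : ℤ) + 1 : ℝ) * (2 * θ) = Real.pi - θ := by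
        rw [← hmθ, hk]; push_cast; ring
      rw [a1, a2, Real.sin_pi_sub, add_comm Real.pi θ, Real.sin_add_pi]
      simp
    rw [e1, e2, e3, e4, hz]
    simp

/-- The geometric representation of `W` on `B → ℝ`, where the simple root `α_i` is given the
length `c i`; the simple reflection `s_i` acts by `v ↦ v - 2 (α_i, v) / (α_i, α_i) α_i`. -/
noncomputable def geomRep (c : B → Set.Ioi (0 : ℝ)) : W →* ((B → ℝ) ≃ₗ[ℝ] (B → ℝ)) :=
  cs.lift ⟨M.simpleReflection c, isLiftable_simpleReflection c⟩

/-- The choice of lengths for which all roots have length one. -/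
def unitLengths : B → Set.Ioi (0 : ℝ) := fun _ => ⟨1, Set.mem_Ioi.2 zero_lt_one⟩

/-- The vector `α` is one of the two roots whose reflection is `t`:
`α = w(α_i)` and `t = w s_i w⁻¹` for some `w` and `i`. -/
def IsRootOf (c : B → Set.Ioi (0 : ℝ)) (t : W) (α : B → ℝ) : Prop :=
  ∃ w i, t = w * cs.simple i * w⁻¹ ∧ α = cs.geomRep c w (simpleRoot i)

/-- The root system: the orbit of the simple roots. -/
def roots (c : B → Set.Ioi (0 : ℝ)) : Set (B → ℝ) :=
  {α | ∃ w i, α = cs.geomRep c w (simpleRoot i)}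

/-- The positive roots: those with nonnegative coordinates with respect to the simple roots. -/
def posRoots (c : B → Set.Ioi (0 : ℝ)) : Set (B → ℝ) :=
  {α ∈ cs.roots c | ∀ i, 0 ≤ α i}

/-- The moved space of `w`: the image of `w - id`. -/
noncomputable def moved (c : B → Set.Ioi (0 : ℝ)) (w : W) : Submodule ℝ (B → ℝ) :=
  LinearMap.range ((cs.geomRep c w : (B → ℝ) →ₗ[ℝ] (B → ℝ)) - LinearMap.id)

/-! ### Crystallographic root systems and reduction modulo a prime -/

/-- With the lengths `c`, the roots form a (reduced) crystallographic root system. -/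
structure IsCrystallographic (c : B → Set.Ioi (0 : ℝ)) : Prop where
  reduced : ∀ α ∈ cs.roots c, ∀ k : ℝ, k • α ∈ cs.roots c → k = 1 ∨ k = -1
  integral : ∀ α ∈ cs.roots c, ∀ β ∈ cs.roots c,
    ∃ n : ℤ, 2 * M.rootForm c α β / M.rootForm c β β = n

/-- The inclusion of the lattice `V_ℤ` spanned by the simple roots. -/
def intVec : (B → ℤ) →+ (B → ℝ) := (Int.castAddHom ℝ).compLeft B

/-- The reduction map from `V_ℤ` to the `𝔽_p`-vector space on the simple roots. -/
def reduceMod (p : ℕ) : (B → ℤ) →+ (B → ZMod p) := (Int.castAddHom (ZMod p)).compLeft B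

/-- The prime `p` is compatible with the root system: each basis of `V` consisting of positive
roots (which are integer vectors) is reduced modulo `p` to a basis. -/
def IsCompatible (c : B → Set.Ioi (0 : ℝ)) (p : ℕ) : Prop :=
  ∀ b : B → (B → ℤ), (∀ i, intVec (b i) ∈ cs.posRoots c) →
    LinearIndependent ℝ (fun i => intVec (b i)) →
    Submodule.span ℝ (Set.range fun i => intVec (b i)) = ⊤ →
    LinearIndependent (ZMod p) (fun i => reduceMod p (b i)) ∧
      Submodule.span (ZMod p) (Set.range fun i => reduceMod p (b i)) = ⊤

/-- The integral moved space: the integer vectors in the moved space. -/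
noncomputable def intMoved (c : B → Set.Ioi (0 : ℝ)) (w : W) : AddSubgroup (B → ℤ) :=
  (cs.moved c w).toAddSubgroup.comap intVec

/-- The `p`-moved space: the reduction modulo `p` of the integral moved space. -/
noncomputable def modMoved (c : B → Set.Ioi (0 : ℝ)) (p : ℕ) (w : W) :
    Submodule (ZMod p) (B → ZMod p) :=
  AddSubgroup.toZModSubmodule p ((cs.intMoved c w).map (reduceMod p))

/-- The vector `a` over `𝔽_p` is the reduction of one of the two roots whose reflection is `t`. -/
def IsModRootOf (c : B → Set.Ioi (0 : ℝ)) (p : ℕ) (t : W) (a : B → ZMod p) : Prop :=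
  ∃ α : B → ℤ, cs.IsRootOf c t (intVec α) ∧ a = reduceMod p α

end Geometric

/-! ### Unique extension of an automorphism of the non-crossing partitions -/

section Extension

variable {K V : Type*} [Field K] [AddCommGroup V] [Module K V]

/-- The automorphism of the lattice of subspaces induced by a linear automorphism. -/
def inducedAut (ψ : V ≃ₗ[K] V) : Submodule K V ≃o Submodule K V :=
  Submodule.orderIsoMapComap ψ

/-- The type-preserving simplicial automorphisms of the building `|Λ(V)|`; the type of a vertex is
the dimension of the subspace. -/
noncomputable def buildingAut (K V : Type*) [Field K] [AddCommGroup V] [Module K V] :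
    Subgroup (Equiv.Perm (ProperPart (Submodule K V))) :=
  typePreservingAut (orderComplex (Submodule K V)) fun U => Module.finrank K U.1

/-- The type-preserving simplicial automorphisms of the complex `|NC(W, c)|`; the type of a vertex
is its rank, that is, its absolute length. -/
noncomputable def complexAut (c : W) : Subgroup (Equiv.Perm (ProperPart (cs.NC c))) :=
  typePreservingAut (orderComplex (cs.NC c)) fun w => cs.absLength w.1.val

/-- The automorphism `φ` of `NC(W, c)` extends along `f : NC(W, c) → Λ(V)`, and in which sense the
extension is unique; `IsRoot t` holds for the roots (over `K`) belonging to the reflection `t`. -/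
structure ExtendsUniquely {c : W} (f : cs.NC c → Submodule K V) (IsRoot : W → V → Prop)
    (φ : cs.NC c ≃o cs.NC c) : Prop where
  /-- The induced vertex map of `|NC(W, c)|` is a type-preserving simplicial automorphism. -/
  properPerm_mem : properPerm φ ∈ cs.complexAut c
  exists_unique : ∃ ψ : V ≃ₗ[K] V,
    -- the linear map sends `α_t` to `± α_{φ(t)}` for all reflections `t`
    (∀ t : cs.NC c, cs.IsReflection t.val → ∀ α β, IsRoot t.val α → IsRoot (φ t).val β →
      ψ α = β ∨ ψ α = -β) ∧
    -- the automorphism of `Λ(V)` induced by it extends `φ`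
    ExtendsAlong f φ (inducedAut ψ) ∧
    -- the induced automorphism of the building extends the one of the complex
    properPerm (inducedAut ψ) ∈ buildingAut K V ∧
    ExtendsAlongSimplicially f (properPerm φ) (properPerm (inducedAut ψ)) ∧
    -- in the irreducible case it is the only linearly induced extension
    (M.IsIrreducible → ∀ ψ' : V ≃ₗ[K] V, ExtendsAlong f φ (inducedAut ψ') →
      inducedAut ψ' = inducedAut ψ) ∧
    -- in the irreducible case of rank different from two it is the only extension
    (M.IsIrreducible → Module.finrank K V ≠ 2 →
      (∀ Ψ : Submodule K V ≃o Submodule K V, ExtendsAlong f φ Ψ → Ψ = inducedAut ψ) ∧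
      (∀ Θ ∈ buildingAut K V, ExtendsAlongSimplicially f (properPerm φ) Θ →
        Θ = properPerm (inducedAut ψ)))

end Extension

end CoxeterSystem

/-! ### Rigidity of automorphisms of the lattice of subspaces -/

namespace SubspaceLattice

open Submodule

section Field

variable {K B : Type*} [Field K]

/-! Existence. Both generators of the dihedral group have the form `w ↦ g w⁻¹ g⁻¹`, so each of its
elements is conjugation by some `g`, possibly composed with inversion
(`exists_conj_of_mem_dihedralAut`). Moved spaces are equivariant under conjugation and do not see
inversion, so the linear action of `g` extends `φ`. Uniqueness. Two extensions differ by a lattice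
automorphism fixing `f(w)` for all `w ≤ c`. After conjugation `c` is a product of the simple
reflections. Then all `s_i` lie below `c`, and for `i ≠ j` so does `s_i s_j s_i` or `s_j s_i s_j`
(`simple_conj_absLE`). The automorphism therefore fixes the coordinate lines and, for each edge of
the diagram, a line in the coordinate plane of the edge other than its two axes. On a connected
diagram this forces triviality: a linear map has equal eigenvalues along edges, while a general
automorphism is treated by a coordinate version of the fundamental theorem of projective geometry
(`eq_refl_of_fixes`). The latter needs a third coordinate beside any two, hence rank `≠ 2`, and a
field whose only ring endomorphism is the identity, as for `ℝ` and `𝔽_p`. `IsMovedMap` lists what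
the argument needs from `f`; it is verified over `ℝ`, and over `𝔽_p` by passing through integer
vectors. -/

theorem eq_refl_of_forall_span_singleton {Ψ : Submodule K (B → K) ≃o Submodule K (B → K)}
    (h : ∀ v : B → K, v ≠ 0 → Ψ (span K {v}) = span K {v}) :
    Ψ = OrderIso.refl _ := by
  ext U v
  by_cases hv : v = 0
  · simp [hv]
  · rw [← span_singleton_le_iff_mem, ← h v hv, Ψ.le_iff_le, span_singleton_le_iff_mem]
    rfl

variable [DecidableEq B]

/-! ### Algebra of the coordinate maps of a lattice automorphism -/

section Coordinates

variable {Ψ : Submodule K (B → K) ≃o Submodule K (B → K)} {σ : B → B → K → K}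
  (h0 : ∀ i j x, σ i j x = 0 ↔ x = 0)
  (hσ : ∀ i v, v i = 1 → Ψ (span K {v}) = span K {fun j => if j = i then 1 else σ i j (v j)})
include h0 hσ

/-- The line of `e_i + a e_j + ab e_k` can be normalised at `i` or, after dividing by `a`, at `j`;
the two descriptions of its image are proportional. -/
theorem coordinate_maps_mul {i j k : B} (hij : i ≠ j) (hik : i ≠ k) (hjk : j ≠ k) (a b : K) :
    σ i k (a * b) = σ i j a * σ j k b := by
  by_cases ha : a = 0
  · rw [ha, zero_mul, (h0 i k 0).2 rfl, (h0 i j 0).2 rfl, zero_mul]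
  let v : B → K := Pi.single i 1 + Pi.single j a + Pi.single k (a * b)
  have hv1 := hσ i v (by simp [v, hij, hik])
  have hv2 := hσ j (a⁻¹ • v) (by simp [v, hij.symm, hjk, ha])
  rw [span_singleton_smul_eq (IsUnit.mk0 _ (inv_ne_zero ha)), hv1] at hv2
  obtain ⟨c, hc⟩ := mem_span_singleton.1
    (hv2 ▸ mem_span_singleton_self (fun l => if l = i then (1 : K) else σ i l (v l)))
  have e1 := congrFun hc j
  have e2 := congrFun hc k
  simp [v, hij.symm, hik.symm, hjk, hjk.symm, ha] at e1 e2
  rw [← e2, ← e1]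

/-- The vector `e_i + (x + y) e_j + e_k` is the sum of `e_i + x e_j` and `e_k + y e_j`. On the
images the coefficients must be `1` and `σ i k 1`, and `σ i k 1 * σ k j y = σ i j y`. -/
theorem coordinate_maps_add {i j k : B} (hij : i ≠ j) (hik : i ≠ k) (hjk : j ≠ k) (x y : K) :
    σ i j (x + y) = σ i j x + σ i j y := by
  let v : B → K := Pi.single i 1 + Pi.single j (x + y) + Pi.single k 1
  let v1 : B → K := Pi.single i 1 + Pi.single j x
  let v2 : B → K := Pi.single k 1 + Pi.single j y
  have hle : span K {v} ≤ span K {v1} ⊔ span K {v2} := by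
    rw [span_singleton_le_iff_mem]
    refine mem_sup.2 ⟨v1, mem_span_singleton_self _, v2, mem_span_singleton_self _, ?_⟩
    simp only [v, v1, v2, Pi.single_add]
    abel
  rw [← Ψ.le_iff_le, OrderIso.map_sup, hσ i v (by simp [v, hij, hik]), hσ i v1 (by simp [v1, hij]),
    hσ k v2 (by simp [v2, hjk.symm]), span_singleton_le_iff_mem] at hle
  obtain ⟨y1, hy1, y2, hy2, hyz⟩ := mem_sup.1 hle
  obtain ⟨a, rfl⟩ := mem_span_singleton.1 hy1
  obtain ⟨b, rfl⟩ := mem_span_singleton.1 hy2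
  have e1 := congrFun hyz i
  have e2 := congrFun hyz j
  have e3 := congrFun hyz k
  have hz : ∀ i j, σ i j 0 = 0 := fun i j => (h0 i j 0).2 rfl
  simp [v, v1, v2, hij, hij.symm, hik, hik.symm, hjk, hjk.symm, hz] at e1 e2 e3
  rw [← e2, e1, e3, one_mul, ← coordinate_maps_mul h0 hσ hik hij hjk.symm, one_mul]

/-- Scaled to send `1` to `1`, the map `σ i j` is a ring endomorphism of `K`; multiplicativity comes
from factoring through the third index `k`. -/
theorem coordinate_maps_eq_mul [Subsingleton (K →+* K)] {i j k : B} (hij : i ≠ j) (hik : i ≠ k)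
    (hjk : j ≠ k) (x : K) : σ i j x = σ i j 1 * x := by
  have h1 : σ i j 1 ≠ 0 := fun h => one_ne_zero ((h0 i j 1).1 h)
  let τ : K →+* K :=
    { toFun := fun x => (σ i j 1)⁻¹ * σ i j x
      map_one' := inv_mul_cancel₀ h1
      map_zero' := by rw [(h0 i j 0).2 rfl, mul_zero]
      map_add' := fun x y => by rw [coordinate_maps_add h0 hσ hij hik hjk, mul_add]
      map_mul' := fun x y => by
        have hm := fun a b => coordinate_maps_mul h0 hσ hik hij hjk.symm a b
        have e1 := hm x 1
        have e2 := hm 1 y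
        have e3 := hm 1 1
        have e4 := hm x y
        rw [mul_one] at e1
        rw [one_mul] at e2
        rw [one_mul] at e3
        field_simp
        rw [e4, e1, e2, e3]
        ring }
  have hτ : (σ i j 1)⁻¹ * σ i j x = x := RingHom.congr_fun (Subsingleton.elim τ (RingHom.id K)) x
  rw [← hτ, mul_inv_cancel_left₀ h1, hτ]

end Coordinates

/-! ### Coordinate hyperplanes and existence of coordinate maps -/

variable [Fintype B]

theorem ker_proj_eq_iSup (k : B) :
    LinearMap.ker (LinearMap.proj k : (B → K) →ₗ[K] K) =
      ⨆ j : {j : B // j ≠ k}, span K {(Pi.single j.1 1 : B → K)} := by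
  apply le_antisymm
  · intro v hv
    have hv : v k = 0 := hv
    rw [pi_eq_sum_univ' v]
    refine Submodule.sum_mem _ fun j _ => ?_
    by_cases hj : j = k
    · rw [hj, hv, zero_smul]
      exact Submodule.zero_mem _
    · refine Submodule.smul_mem _ _ (Submodule.mem_iSup_of_mem ⟨j, hj⟩ ?_)
      refine mem_span_singleton.2 ⟨1, ?_⟩
      ext i
      simp [Pi.single_apply, eq_comm]
  · refine iSup_le fun j => ?_
    rw [span_singleton_le_iff_mem, LinearMap.mem_ker, LinearMap.proj_apply,
      Pi.single_eq_of_ne j.2.symm]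

variable {Ψ : Submodule K (B → K) ≃o Submodule K (B → K)}

/-- A coordinate hyperplane is the join of the other, fixed, coordinate lines. -/
theorem map_ker_proj (hΨ : ∀ i, Ψ (span K {Pi.single i 1}) = span K {Pi.single i 1}) (k : B) :
    Ψ (LinearMap.ker (LinearMap.proj k : (B → K) →ₗ[K] K)) = LinearMap.ker (LinearMap.proj k) := by
  rw [ker_proj_eq_iSup, OrderIso.map_iSup]
  simp only [hΨ]

/-- Lines are the atoms of the lattice, and a coordinate vanishes on a line exactly when the line
lies in the corresponding fixed hyperplane. -/
theorem exists_map_span_singleton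
    (hΨ : ∀ i, Ψ (span K {Pi.single i 1}) = span K {Pi.single i 1}) (i : B) (v : B → K)
    (hv : v i ≠ 0) :
    ∃ u : B → K, u i = 1 ∧ Ψ (span K {v}) = span K {u} ∧ ∀ k, u k = 0 ↔ v k = 0 := by
  have hv0 : v ≠ 0 := fun h => hv (by rw [h]; rfl)
  have hatom : IsAtom (Ψ (span K {v})) := (Ψ.isAtom_iff _).2 (nonzero_span_atom v hv0)
  obtain ⟨w, -, hw⟩ := (atom_iff_nonzero_span _).1 hatom
  have hker : ∀ k, w k = 0 ↔ v k = 0 := by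
    intro k
    have h1 : ∀ x : B → K, x k = 0 ↔
        span K {x} ≤ LinearMap.ker (LinearMap.proj k : (B → K) →ₗ[K] K) := by
      intro x
      rw [span_singleton_le_iff_mem, LinearMap.mem_ker, LinearMap.proj_apply]
    rw [h1, h1, ← hw, ← Ψ.le_iff_le (x := span K {v}), map_ker_proj hΨ]
  have hwi : w i ≠ 0 := fun h => hv ((hker i).1 h)
  refine ⟨(w i)⁻¹ • w, by simp [hwi], ?_, fun k => by simp [hwi, hker]⟩
  rw [hw, span_singleton_smul_eq (IsUnit.mk0 _ (inv_ne_zero hwi))]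

/-- In affine coordinates, a lattice automorphism fixing the coordinate lines acts on each
coordinate separately. -/
theorem exists_coordinate_maps
    (hΨ : ∀ i, Ψ (span K {Pi.single i 1}) = span K {Pi.single i 1}) :
    ∃ σ : B → B → K → K, (∀ i j x, σ i j x = 0 ↔ x = 0) ∧ ∀ i v, v i = 1 →
      Ψ (span K {v}) = span K {fun j => if j = i then 1 else σ i j (v j)} := by
  have key : ∀ (i : B) (v : B → K), ∃ u : B → K, v i ≠ 0 →
      u i = 1 ∧ Ψ (span K {v}) = span K {u} ∧ ∀ k, u k = 0 ↔ v k = 0 := by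
    intro i v
    by_cases hv : v i = 0
    · exact ⟨0, fun h => absurd hv h⟩
    · obtain ⟨u, hu⟩ := exists_map_span_singleton hΨ i v hv
      exact ⟨u, fun _ => hu⟩
  choose F hF using key
  -- The diagonal value is arbitrary; the identity makes the vanishing condition hold for every
  -- pair.
  refine ⟨fun i j x => if i = j then x else F i (Pi.single i 1 + Pi.single j x) j, ?_, ?_⟩
  · intro i j x
    by_cases hij : i = j
    · simp [hij]
    · have := (hF i (Pi.single i 1 + Pi.single j x) (by simp [hij])).2.2 j
      simp only [if_neg hij, this, Pi.add_apply, Pi.single_eq_same,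
        Pi.single_eq_of_ne (Ne.symm hij), zero_add]
  · intro i v hv
    obtain ⟨h1, h2, -⟩ := hF i v (by rw [hv]; exact one_ne_zero)
    rw [h2]
    congr 2
    ext j
    by_cases hj : j = i
    · simp [hj, h1]
    have hij : i ≠ j := Ne.symm hj
    simp only [if_neg hj, if_neg hij]
    set e : B → K := Pi.single i 1 + Pi.single j (v j) with he
    obtain ⟨g1, g2, -⟩ := hF i e (by simp [he, hij])
    -- `v` and `e` agree in coordinates `i` and `j`, so they differ by a vector in two fixed
    -- hyperplanes. Hence coordinate `j` of the image depends on `v j` alone.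
    have hle : span K {v} ≤ span K {e} ⊔ (LinearMap.ker (LinearMap.proj i : (B → K) →ₗ[K] K) ⊓
        LinearMap.ker (LinearMap.proj j)) := by
      rw [span_singleton_le_iff_mem]
      refine mem_sup.2 ⟨e, mem_span_singleton_self e, v - e, ⟨?_, ?_⟩, by abel⟩
      · simp [he, hv, hij]
      · simp [he, hj]
    rw [← Ψ.le_iff_le, h2, OrderIso.map_sup, OrderIso.map_inf, map_ker_proj hΨ, map_ker_proj hΨ,
      g2, span_singleton_le_iff_mem] at hle
    obtain ⟨y, hy, z, ⟨hz1, hz2⟩, hyz⟩ := mem_sup.1 hle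
    obtain ⟨a, rfl⟩ := mem_span_singleton.1 hy
    have hz1 : z i = 0 := hz1
    have hz2 : z j = 0 := hz2
    have e1 := congrFun hyz i
    have e2 := congrFun hyz j
    simp only [Pi.add_apply, Pi.smul_apply, smul_eq_mul, hz1, hz2, g1, h1, add_zero, mul_one]
      at e1 e2
    rw [← e2, e1, one_mul]

/-! ### Automorphisms fixing a frame and one general line per edge -/

variable {G : SimpleGraph B} (hG : G.Connected)
  (hΨ : ∀ i, Ψ (span K {Pi.single i 1}) = span K {Pi.single i 1})
  (hE : ∀ i j, G.Adj i j → ∃ a b : K, a ≠ 0 ∧ b ≠ 0 ∧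
    Ψ (span K {Pi.single i a + Pi.single j b}) = span K {Pi.single i a + Pi.single j b})
include hG hΨ hE

/-- A lattice automorphism fixing the coordinate lines and a general point on the line through the
`i`-th and the `j`-th of them for each edge `{i, j}` of a connected graph is trivial. -/
theorem eq_refl_of_fixes [Subsingleton (K →+* K)] (hB : Fintype.card B ≠ 2) :
    Ψ = OrderIso.refl _ := by
  refine eq_refl_of_forall_span_singleton fun v hv => ?_
  obtain ⟨σ, h0, hσ⟩ := exists_coordinate_maps hΨ
  -- If no third index existed, `{i, j}` would be all of `B`. For at most one index the claim is
  -- vacuous.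
  have hthird : ∀ i j : B, i ≠ j → ∃ k, i ≠ k ∧ j ≠ k := by
    intro i j hij
    by_contra! hk
    refine hB ?_
    rw [← Finset.card_univ, ← Finset.card_pair hij]
    congr 1
    ext k
    have := hk k
    simp only [Finset.mem_univ, Finset.mem_insert, Finset.mem_singleton, true_iff]
    by_cases h : i = k
    · exact Or.inl h.symm
    · exact Or.inr (this h).symm
  have hadj : ∀ i j, G.Adj i j → σ i j 1 = 1 := by
    intro i j hij
    have hne := hij.ne
    obtain ⟨a, b, ha, hb, hab⟩ := hE i j hij
    obtain ⟨k, hik, hjk⟩ := hthird i j hne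
    set v : B → K := Pi.single i a + Pi.single j b with hv
    have h1 := hσ i (a⁻¹ • v) (by simp [hv, hne, ha])
    rw [span_singleton_smul_eq (IsUnit.mk0 _ (inv_ne_zero ha)), hab] at h1
    obtain ⟨c, hc⟩ := mem_span_singleton.1 (h1 ▸ mem_span_singleton_self v)
    have e1 := congrFun hc i
    have e2 := congrFun hc j
    simp only [hv, Pi.smul_apply, Pi.add_apply, Pi.single_eq_same, Pi.single_eq_of_ne hne,
      Pi.single_eq_of_ne hne.symm, if_neg hne.symm, smul_eq_mul, if_true, mul_one, zero_add,
      add_zero] at e1 e2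
    rw [coordinate_maps_eq_mul h0 hσ hne hik hjk, e1] at e2
    field_simp at e2
    exact e2
  -- Multiplicativity carries the normalisation from edges along walks.
  have hone : ∀ i j, i ≠ j → σ i j 1 = 1 := by
    intro i j
    obtain ⟨p⟩ := hG.preconnected i j
    induction p with
    | nil => exact fun h => absurd rfl h
    | @cons i j k hij p ih =>
      intro hik
      by_cases hjk : j = k
      · exact hjk ▸ hadj i j hij
      · rw [← one_mul (1 : K), coordinate_maps_mul h0 hσ hij.ne hik hjk, hadj i j hij, ih hjk]
  obtain ⟨i, hi⟩ := Function.ne_iff.1 hv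
  have hi : v i ≠ 0 := hi
  have h1 := hσ i ((v i)⁻¹ • v) (by simp [hi])
  have h2 : (fun j => if j = i then (1 : K) else σ i j (((v i)⁻¹ • v) j)) = (v i)⁻¹ • v := by
    ext j
    by_cases hj : j = i
    · simp [hj, hi]
    · obtain ⟨k, hik, hjk⟩ := hthird i j (Ne.symm hj)
      rw [if_neg hj, coordinate_maps_eq_mul h0 hσ (Ne.symm hj) hik hjk, hone i j (Ne.symm hj),
        one_mul]
  rwa [h2, span_singleton_smul_eq (IsUnit.mk0 _ (inv_ne_zero hi))] at h1

/-- The linear analogue of `eq_refl_of_fixes`. -/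
theorem eq_refl_of_fixes_of_linear (χ : (B → K) ≃ₗ[K] (B → K))
    (hχ : ∀ U, Ψ U = U.map (χ : (B → K) →ₗ[K] (B → K))) : Ψ = OrderIso.refl _ := by
  have hmap : ∀ v, Ψ (span K {v}) = span K {χ v} := fun v => by
    rw [hχ, map_span, Set.image_singleton]
    rfl
  have hex : ∀ i, ∃ a : K, χ (Pi.single i 1) = a • Pi.single i 1 := by
    intro i
    have h1 := hΨ i
    rw [hmap] at h1
    obtain ⟨a, ha⟩ := mem_span_singleton.1
      (h1 ▸ mem_span_singleton_self (χ (Pi.single i (1 : K))))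
    exact ⟨a, ha.symm⟩
  choose a ha using hex
  have ha' : ∀ i x, χ (Pi.single i x) = Pi.single i (a i * x) := by
    intro i x
    have : (Pi.single i x : B → K) = x • Pi.single i 1 := by
      rw [← Pi.single_smul, smul_eq_mul, mul_one]
    rw [this, map_smul, ha, ← Pi.single_smul, ← Pi.single_smul]
    congr 1
    simp [mul_comm]
  -- Fixing a line with both coordinates nonzero makes the two eigenvalues equal.
  have hadj : ∀ i j, G.Adj i j → a i = a j := by
    intro i j hij
    obtain ⟨x, y, hx, hy, hxy⟩ := hE i j hij
    rw [hmap, map_add, ha', ha'] at hxy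
    obtain ⟨c, hc⟩ := mem_span_singleton.1 (hxy ▸ mem_span_singleton_self _)
    have e1 := congrFun hc i
    have e2 := congrFun hc j
    simp only [Pi.smul_apply, Pi.add_apply, Pi.single_eq_same, Pi.single_eq_of_ne hij.ne,
      Pi.single_eq_of_ne hij.ne.symm, smul_eq_mul, zero_add, add_zero] at e1 e2
    rw [← mul_right_cancel₀ hx e1, ← mul_right_cancel₀ hy e2]
  have hconst : ∀ i j, a i = a j := by
    intro i j
    obtain ⟨p⟩ := hG.preconnected i j
    induction p with
    | nil => rfl
    | cons h p ih => exact (hadj _ _ h).trans ih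
  obtain ⟨i⟩ := hG.nonempty
  have hχ' : ∀ v, χ v = a i • v := by
    intro v
    have : v = ∑ j, Pi.single j (v j) := (Finset.univ_sum_single v).symm
    rw [this, map_sum, Finset.smul_sum]
    refine Finset.sum_congr rfl fun j _ => ?_
    rw [ha', hconst j i, ← Pi.single_smul, smul_eq_mul]
  refine eq_refl_of_forall_span_singleton fun v hv => ?_
  have hai : a i ≠ 0 := by
    intro h
    refine hv (χ.injective ?_)
    rw [hχ', h, zero_smul, map_zero]
  rw [hmap, hχ', span_singleton_smul_eq (IsUnit.mk0 _ hai)]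

end Field

end SubspaceLattice

namespace CoxeterSystem

/-! ### Subwords of a reduced reflection factorization -/

section Subwords

variable {B : Type*} {W : Type*} [Group W] {M : CoxeterMatrix B} (cs : CoxeterSystem M W)

/-- Conjugating the factors that precede `t` brings `t` to the front, leaving one factor fewer for
`t⁻¹ c`; subadditivity gives the other inequality. -/
theorem absLE_of_mem {c t : W} {L : List W} (hL : ∀ u ∈ L, cs.IsReflection u) (hc : L.prod = c)
    (hlen : L.length = cs.absLength c) (ht : t ∈ L) : cs.AbsLE t c := by
  obtain ⟨L₁, L₂, rfl⟩ := List.append_of_mem ht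
  have htr : cs.IsReflection t := hL t ht
  have h1 : cs.absLength t ≤ 1 := cs.absLength_le [t] (by simpa using htr) (by simp)
  have h2 : cs.absLength (t⁻¹ * c) ≤ L₁.length + L₂.length := by
    have := cs.absLength_le (w := t⁻¹ * c) (L₁.map (MulAut.conj t⁻¹) ++ L₂) ?_ ?_
    · simpa using this
    · intro u hu
      rcases List.mem_append.1 hu with hu | hu
      · obtain ⟨x, hx, rfl⟩ := List.mem_map.1 hu
        exact (hL x (by simp [hx])).conj t⁻¹
      · exact hL u (by simp [hu])
    · rw [List.prod_append, ← map_list_prod, MulAut.conj_apply, ← hc, List.prod_append,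
        List.prod_cons]
      group
  have h3 := cs.absLength_mul_le t (t⁻¹ * c)
  rw [mul_inv_cancel_left] at h3
  rw [List.length_append, List.length_cons] at hlen
  unfold AbsLE
  omega

/-- Hurwitz moves: with `x` the product of `L₂`, one has `s x t = (s t s⁻¹) s (t⁻¹ x t)`. -/
theorem exists_mem_conj_of_append {s t : W} (L₁ L₂ L₃ : List W)
    (hL : ∀ u ∈ L₁ ++ s :: (L₂ ++ t :: L₃), cs.IsReflection u) :
    ∃ L : List W, (∀ u ∈ L, cs.IsReflection u) ∧ L.prod = (L₁ ++ s :: (L₂ ++ t :: L₃)).prod ∧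
      L.length = (L₁ ++ s :: (L₂ ++ t :: L₃)).length ∧ s * t * s⁻¹ ∈ L := by
  refine ⟨L₁ ++ (s * t * s⁻¹) :: s :: (L₂.map (MulAut.conj t⁻¹) ++ L₃), ?_, ?_, ?_, by simp⟩
  · intro u hu
    simp only [List.mem_append, List.mem_cons, List.mem_map] at hu
    rcases hu with hu | rfl | rfl | ⟨x, hx, rfl⟩ | hu
    · exact hL u (by simp [hu])
    · exact (hL t (by simp)).conj s
    · exact hL u (by simp)
    · exact (hL x (by simp [hx])).conj t⁻¹
    · exact hL u (by simp [hu])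
  · simp only [List.prod_append, List.prod_cons, ← map_list_prod, MulAut.conj_apply]
    group
  · simp
    omega

theorem simple_absLE {c : W} {ω : List B} (hω : cs.wordProd ω = c)
    (hlen : ω.length = cs.absLength c) {i : B} (hi : i ∈ ω) : cs.AbsLE (cs.simple i) c := by
  refine cs.absLE_of_mem (L := ω.map cs.simple) ?_ hω (by simpa using hlen)
    (List.mem_map_of_mem hi)
  intro t ht
  obtain ⟨j, -, rfl⟩ := List.mem_map.1 ht
  exact cs.isReflection_simple j

/-- The letter occurring first in `ω` conjugates the later one, hence the two alternatives. -/
theorem simple_conj_absLE {c : W} {ω : List B} (hω : cs.wordProd ω = c)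
    (hlen : ω.length = cs.absLength c) {i j : B} (hi : i ∈ ω) (hj : j ∈ ω) (hij : i ≠ j) :
    cs.AbsLE (cs.simple i * cs.simple j * (cs.simple i)⁻¹) c ∨
      cs.AbsLE (cs.simple j * cs.simple i * (cs.simple j)⁻¹) c := by
  have key : ∀ i j : B, (∃ l₁ l₂ l₃, ω = l₁ ++ i :: (l₂ ++ j :: l₃)) →
      cs.AbsLE (cs.simple i * cs.simple j * (cs.simple i)⁻¹) c := by
    rintro i j ⟨l₁, l₂, l₃, rfl⟩
    obtain ⟨L, h1, h2, h3, h4⟩ := cs.exists_mem_conj_of_append (s := cs.simple i)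
      (t := cs.simple j) (l₁.map cs.simple) (l₂.map cs.simple) (l₃.map cs.simple) (by
        intro t ht
        simp only [List.mem_append, List.mem_cons, List.mem_map] at ht
        rcases ht with ⟨k, -, rfl⟩ | rfl | ⟨k, -, rfl⟩ | rfl | ⟨k, -, rfl⟩ <;>
          exact cs.isReflection_simple _)
    refine cs.absLE_of_mem h1 (h2.trans ?_) (h3.trans ?_) h4
    · rw [← hω, wordProd]
      simp
    · rw [← hlen]
      simp
  obtain ⟨l₁, l₂, rfl⟩ := List.append_of_mem hi
  rcases List.mem_append.1 hj with h | h
  · obtain ⟨l₃, l₄, rfl⟩ := List.append_of_mem h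
    exact Or.inr (key j i ⟨l₃, l₄, l₂, by simp⟩)
  · rcases List.mem_cons.1 h with h | h
    · exact absurd h.symm hij
    · obtain ⟨l₃, l₄, rfl⟩ := List.append_of_mem h
      exact Or.inl (key i j ⟨l₁, l₃, l₄, rfl⟩)

end Subwords

/-! ### The dihedral group acts by conjugation up to inversion -/

section Dihedral

variable {B : Type*} {W : Type*} [Group W] {M : CoxeterMatrix B} (cs : CoxeterSystem M W)

/-- Inversion commutes with conjugations, so the maps of these two forms are closed under
composition and inverses. -/
theorem exists_conj_of_mem_dihedralAut {c l r : W} (h : IsBipartition c l r) {φ : cs.NC c ≃o cs.NC c}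
    (hφ : φ ∈ cs.dihedralAut h) :
    ∃ g : W, (∀ w, (φ w).val = g * w.val * g⁻¹) ∨ ∀ w, (φ w).val = g * w.val⁻¹ * g⁻¹ := by
  induction hφ using Subgroup.closure_induction with
  | mem φ hφ =>
    have hl : l⁻¹ = l := inv_eq_of_mul_eq_one_right h.left_sq
    have hr : r⁻¹ = r := inv_eq_of_mul_eq_one_right h.right_sq
    rcases hφ with rfl | hφ
    · exact ⟨l, Or.inr fun w => by rw [hl]; rfl⟩
    · rw [Set.mem_singleton_iff] at hφ
      subst hφ
      exact ⟨r, Or.inr fun w => by rw [hr]; rfl⟩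
  | one => exact ⟨1, Or.inl fun w => by simp⟩
  | mul φ χ _ _ h1 h2 =>
    obtain ⟨g, hg⟩ := h1
    obtain ⟨k, hk⟩ := h2
    refine ⟨g * k, ?_⟩
    rcases hg with hg | hg <;> rcases hk with hk | hk
    · left; intro w; rw [RelIso.mul_apply, hg, hk]; group
    · right; intro w; rw [RelIso.mul_apply, hg, hk]; group
    · right; intro w; rw [RelIso.mul_apply, hg, hk]; group
    · left; intro w; rw [RelIso.mul_apply, hg, hk]; group
  | inv φ _ h1 =>
    obtain ⟨g, hg⟩ := h1
    refine ⟨g⁻¹, ?_⟩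
    rcases hg with hg | hg
    · left
      intro w
      have := hg (φ⁻¹ w)
      rw [RelIso.apply_inv_self] at this
      rw [this]
      group
    · right
      intro w
      have := hg (φ⁻¹ w)
      rw [RelIso.apply_inv_self] at this
      rw [this]
      group

end Dihedral

/-! ### Moved spaces in the geometric representation -/

section Moved

variable {B : Type*} {W : Type*} [Fintype B] [DecidableEq B] [Group W] {M : CoxeterMatrix B}
  (cs : CoxeterSystem M W) (d : B → Set.Ioi (0 : ℝ))

theorem geomRep_simple_apply (i : B) (v : B → ℝ) :
    cs.geomRep d (cs.simple i) v = v - M.simpleCoroot d i v • simpleRoot i := by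
  rw [geomRep, lift_apply_simple, CoxeterMatrix.simpleReflection, Module.reflection_apply]

theorem mem_moved {w : W} {v : B → ℝ} :
    v ∈ cs.moved d w ↔ ∃ u, cs.geomRep d w u - u = v := by
  simp [moved]

theorem geomRep_mul_apply (g w : W) (v : B → ℝ) :
    cs.geomRep d (g * w) v = cs.geomRep d g (cs.geomRep d w v) := by
  rw [map_mul]; rfl

theorem geomRep_inv_apply_self (g : W) (v : B → ℝ) :
    cs.geomRep d g⁻¹ (cs.geomRep d g v) = v := by
  rw [← geomRep_mul_apply, inv_mul_cancel, map_one]; rfl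

theorem geomRep_apply_inv_self (g : W) (v : B → ℝ) :
    cs.geomRep d g (cs.geomRep d g⁻¹ v) = v := by
  rw [← geomRep_mul_apply, mul_inv_cancel, map_one]; rfl

theorem moved_one : cs.moved d 1 = ⊥ := by
  rw [eq_bot_iff]
  intro v hv
  obtain ⟨u, rfl⟩ := (cs.mem_moved d).1 hv
  simp

theorem moved_conj (g w : W) :
    cs.moved d (g * w * g⁻¹) = (cs.moved d w).map (cs.geomRep d g : (B → ℝ) →ₗ[ℝ] (B → ℝ)) := by
  ext v
  rw [mem_moved, Submodule.mem_map]
  constructor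
  · rintro ⟨u, rfl⟩
    refine ⟨_, (cs.mem_moved d).2 ⟨cs.geomRep d g⁻¹ u, rfl⟩, ?_⟩
    rw [LinearEquiv.coe_coe, map_sub, geomRep_apply_inv_self, geomRep_mul_apply,
      geomRep_mul_apply]
  · rintro ⟨x, hx, rfl⟩
    obtain ⟨u, rfl⟩ := (cs.mem_moved d).1 hx
    refine ⟨cs.geomRep d g u, ?_⟩
    rw [LinearEquiv.coe_coe, map_sub, geomRep_mul_apply, geomRep_mul_apply,
      geomRep_inv_apply_self]

theorem moved_inv (w : W) : cs.moved d w⁻¹ = cs.moved d w := by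
  have key : ∀ w, cs.moved d w ≤ cs.moved d w⁻¹ := by
    intro w v hv
    obtain ⟨u, rfl⟩ := (cs.mem_moved d).1 hv
    refine (cs.mem_moved d).2 ⟨-cs.geomRep d w u, ?_⟩
    rw [map_neg, geomRep_inv_apply_self]
    abel
  exact le_antisymm (by simpa using key w⁻¹) (key w)

theorem moved_mul_le (v w : W) : cs.moved d (v * w) ≤ cs.moved d v ⊔ cs.moved d w := by
  intro x hx
  obtain ⟨u, rfl⟩ := (cs.mem_moved d).1 hx
  refine Submodule.mem_sup.2 ⟨_, (cs.mem_moved d).2 ⟨cs.geomRep d w u, rfl⟩, _,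
    (cs.mem_moved d).2 ⟨u, rfl⟩, ?_⟩
  rw [geomRep_mul_apply]
  abel

theorem moved_simple (i : B) : cs.moved d (cs.simple i) = Submodule.span ℝ {simpleRoot i} := by
  ext v
  rw [mem_moved, Submodule.mem_span_singleton]
  constructor
  · rintro ⟨u, rfl⟩
    refine ⟨-M.simpleCoroot d i u, ?_⟩
    rw [geomRep_simple_apply]
    module
  · rintro ⟨a, rfl⟩
    -- `s_i - id` multiplies `α_i` by `-2`.
    refine ⟨(-a / 2) • simpleRoot i, ?_⟩
    rw [geomRep_simple_apply, map_smul, simpleCoroot_self]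
    module

theorem moved_eq_span_of_isRootOf {t : W} {α : B → ℝ} (h : cs.IsRootOf d t α) :
    cs.moved d t = Submodule.span ℝ {α} := by
  obtain ⟨w, i, rfl, rfl⟩ := h
  rw [moved_conj, moved_simple, Submodule.map_span, Set.image_singleton]
  rfl

/-- Moved spaces are subadditive under products, and a reflection moves only a line. -/
theorem finrank_moved_le (w : W) : Module.finrank ℝ (cs.moved d w) ≤ cs.absLength w := by
  obtain ⟨L, h1, rfl, h3⟩ := cs.exists_absLength w
  rw [← h3]
  clear h3
  induction L with
  | nil => rw [List.prod_nil, moved_one, finrank_bot, List.length_nil]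
  | cons t L ih =>
    obtain ⟨g, i, rfl⟩ := h1 t (by simp)
    have h2 : Module.finrank ℝ (cs.moved d (g * cs.simple i * g⁻¹)) ≤ 1 := by
      rw [cs.moved_eq_span_of_isRootOf d ⟨g, i, rfl, rfl⟩]
      exact (finrank_span_le_card _).trans (by simp)
    have h3 := Submodule.finrank_mono (cs.moved_mul_le d (g * cs.simple i * g⁻¹) L.prod)
    have h4 := Submodule.finrank_add_le_finrank_add_finrank
      (cs.moved d (g * cs.simple i * g⁻¹)) (cs.moved d L.prod)
    have h5 := ih fun u hu => h1 u (by simp [hu])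
    rw [List.prod_cons, List.length_cons]
    omega

/-- In a finite Coxeter group, the simple coroots separate points. -/
theorem eq_zero_of_forall_simpleCoroot [Finite W] (cs : CoxeterSystem M W)
    (d : B → Set.Ioi (0 : ℝ)) {v : B → ℝ}
    (hv : ∀ i, M.simpleCoroot d i v = 0) : v = 0 := by
  have := Fintype.ofFinite W
  -- Averaging the dot product over `W` gives an invariant positive definite form. As `s_i` fixes
  -- `v` and negates `α_i`, every `α_i` is orthogonal to `v`, and so is `v` itself.
  let P : (B → ℝ) → (B → ℝ) → ℝ := fun x y =>
    ∑ w : W, cs.geomRep d w x ⬝ᵥ cs.geomRep d w y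
  have hinv : ∀ g x y, P (cs.geomRep d g x) (cs.geomRep d g y) = P x y := by
    intro g x y
    simp only [P, ← geomRep_mul_apply]
    exact Fintype.sum_equiv (Equiv.mulRight g) _ _ fun w => rfl
  have hneg : ∀ x y, P (-x) y = -P x y := by
    intro x y
    simp [P]
  have hroot : ∀ i, P (simpleRoot i) v = 0 := by
    intro i
    have h1 : cs.geomRep d (cs.simple i) (simpleRoot i) = -simpleRoot i := by
      rw [geomRep_simple_apply, simpleCoroot_self]
      module
    have h2 : cs.geomRep d (cs.simple i) v = v := by
      rw [geomRep_simple_apply, hv, zero_smul, sub_zero]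
    have h3 := hinv (cs.simple i) (simpleRoot i) v
    rw [h1, h2, hneg] at h3
    linarith
  have hall : P v v = 0 := by
    have hsum : ∀ x, P x v = ∑ i, x i * P (simpleRoot i) v := by
      intro x
      simp only [P, Finset.mul_sum]
      rw [Finset.sum_comm]
      refine Finset.sum_congr rfl fun w _ => ?_
      conv_lhs => rw [pi_eq_sum_univ' x, map_sum, sum_dotProduct]
      refine Finset.sum_congr rfl fun i _ => ?_
      rw [map_smul, smul_dotProduct, smul_eq_mul]
      congr 4
    rw [hsum]
    simp [hroot]
  have h1 := (Finset.sum_eq_zero_iff_of_nonneg fun w _ => by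
    exact Finset.sum_nonneg fun i _ => mul_self_nonneg _).1 hall 1 (Finset.mem_univ _)
  rw [map_one] at h1
  exact dotProduct_self_eq_zero.1 h1

/-! ### Fixed and moved spaces of Coxeter elements -/

theorem geomRep_wordProd_apply_of_notMem {ω : List B} {k : B} (hk : k ∉ ω) (v : B → ℝ) :
    cs.geomRep d (cs.wordProd ω) v k = v k := by
  induction ω generalizing v with
  | nil => simp
  | cons i ω ih =>
    rw [List.mem_cons, not_or] at hk
    rw [wordProd_cons, geomRep_mul_apply, geomRep_simple_apply, Pi.sub_apply, ih hk.2]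
    simp [simpleRoot, hk.1]

/-- If `s_i ω v = v`, then `s_i v = ω v`. The right side has the same `i`-th coordinate as `v`,
since `i` does not occur in `ω`; so the `i`-th coroot kills `v`, which is then fixed by `ω`. -/
theorem simpleCoroot_eq_zero_of_fixed {ω : List B} (hω : ω.Nodup) {v : B → ℝ}
    (hv : cs.geomRep d (cs.wordProd ω) v = v) : ∀ i ∈ ω, M.simpleCoroot d i v = 0 := by
  induction ω with
  | nil => simp
  | cons i ω ih =>
    rw [List.nodup_cons] at hω
    rw [wordProd_cons, geomRep_mul_apply] at hv
    have h1 : cs.geomRep d (cs.wordProd ω) v = cs.geomRep d (cs.simple i) v := by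
      rw [← hv, ← geomRep_mul_apply cs d (cs.simple i) (cs.simple i), cs.simple_mul_simple_self,
        map_one, LinearEquiv.coe_one, id, hv]
    have h2 : M.simpleCoroot d i v = 0 := by
      have := cs.geomRep_wordProd_apply_of_notMem d hω.1 v
      rw [h1, geomRep_simple_apply] at this
      simpa [simpleRoot] using this
    rw [geomRep_simple_apply, h2, zero_smul, sub_zero] at h1
    intro j hj
    rcases List.mem_cons.1 hj with rfl | hj
    · exact h2
    · exact ih hω.2 h1 j hj

theorem moved_coxeterElement [Finite W] {c : W} (hc : cs.IsCoxeterElement c) :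
    cs.moved d c = ⊤ := by
  obtain ⟨ω, h1, h2, h3⟩ := hc
  obtain ⟨g, rfl⟩ := isConj_iff.1 h3
  have htop : cs.moved d (cs.wordProd ω) = ⊤ := by
    rw [moved, LinearMap.range_eq_top, ← LinearMap.injective_iff_surjective,
      ← LinearMap.ker_eq_bot, LinearMap.ker_eq_bot']
    intro v hv
    refine cs.eq_zero_of_forall_simpleCoroot d fun i => ?_
    refine cs.simpleCoroot_eq_zero_of_fixed d h1 ?_ i (h2 i)
    simpa [sub_eq_zero] using hv
  rw [moved_conj, htop, Submodule.map_top, LinearEquiv.range]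

theorem absLength_coxeterElement [Finite W] {c : W} (hc : cs.IsCoxeterElement c) :
    cs.absLength c = Fintype.card B := by
  apply le_antisymm
  · obtain ⟨ω, h1, h2, h3⟩ := hc
    obtain ⟨g, rfl⟩ := isConj_iff.1 h3
    rw [absLength_conj]
    refine (cs.absLength_le (ω.map cs.simple) ?_ rfl).trans ?_
    · intro t ht
      obtain ⟨j, -, rfl⟩ := List.mem_map.1 ht
      exact cs.isReflection_simple j
    · rw [List.length_map]
      exact h1.length_le_card
  · have := cs.finrank_moved_le unitLengths c
    rwa [cs.moved_coxeterElement _ hc, finrank_top, Module.finrank_fintype_fun_eq_card] at this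

/-- If `w` moves nothing, `w⁻¹ c` moves everything, so its length is already that of `c`.
Faithfulness of the representation is not needed. -/
theorem eq_one_of_moved_eq_bot [Finite W] {c w : W} (hc : cs.IsCoxeterElement c)
    (hw : cs.AbsLE w c) (h : cs.moved d w = ⊥) : w = 1 := by
  have h1 := cs.moved_mul_le d w (w⁻¹ * c)
  rw [mul_inv_cancel_left, cs.moved_coxeterElement d hc, h, bot_sup_eq, top_le_iff] at h1
  have h2 := cs.finrank_moved_le d (w⁻¹ * c)
  rw [h1, finrank_top, Module.finrank_fintype_fun_eq_card,
    ← cs.absLength_coxeterElement hc] at h2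
  unfold AbsLE at hw
  exact cs.eq_one_of_absLength_eq_zero (by omega)

theorem eq_of_moved_eq_top [Finite W] {c w : W} (hc : cs.IsCoxeterElement c)
    (hw : cs.AbsLE w c) (h : cs.moved d w = ⊤) : w = c := by
  have h2 := cs.finrank_moved_le d w
  rw [h, finrank_top, Module.finrank_fintype_fun_eq_card,
    ← cs.absLength_coxeterElement hc] at h2
  unfold AbsLE at hw
  exact inv_mul_eq_one.1 (cs.eq_one_of_absLength_eq_zero (by omega))

/-! ### Roots -/

theorem rootForm_geomRep (w : W) (x y : B → ℝ) :
    M.rootForm d (cs.geomRep d w x) (cs.geomRep d w y) = M.rootForm d x y := by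
  have hsymm : ∀ x y, M.rootForm d x y = M.rootForm d y x := by
    intro x y
    simp only [CoxeterMatrix.rootForm, Matrix.toBilin'_apply, Matrix.of_apply]
    rw [Finset.sum_comm]
    refine Finset.sum_congr rfl fun i _ => Finset.sum_congr rfl fun j _ => ?_
    rw [M.symmetric j i]
    ring
  induction w using cs.simple_induction generalizing x y with
  | simple i =>
    have hi : M.rootForm d (simpleRoot i) (simpleRoot i) ≠ 0 := by
      rw [rootForm_simpleRoot_self]
      exact pow_ne_zero 2 (d i).2.ne'
    simp only [geomRep_simple_apply, CoxeterMatrix.simpleCoroot, map_sub, map_smul,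
      LinearMap.sub_apply, LinearMap.smul_apply, smul_eq_mul]
    rw [hsymm x (simpleRoot i)]
    field_simp
    ring
  | one => simp
  | mul w w' h h' => rw [geomRep_mul_apply, geomRep_mul_apply, h, h']

theorem IsRootOf.geomRep {t : W} {α : B → ℝ} (h : cs.IsRootOf d t α) (g : W) :
    cs.IsRootOf d (g * t * g⁻¹) (cs.geomRep d g α) := by
  obtain ⟨w, i, rfl, rfl⟩ := h
  exact ⟨g * w, i, by group, by rw [geomRep_mul_apply]⟩

theorem exists_eq_smul_of_isRootOf {t : W} {α β : B → ℝ} (hα : cs.IsRootOf d t α)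
    (hβ : cs.IsRootOf d t β) : ∃ k : ℝ, k • α = β := by
  rw [← Submodule.mem_span_singleton, ← cs.moved_eq_span_of_isRootOf d hα,
    cs.moved_eq_span_of_isRootOf d hβ]
  exact Submodule.mem_span_singleton_self β

/-- Both roots span the moved line of `t`, and the invariant form gives both norm one. -/
theorem eq_or_eq_neg_of_isRootOf {t : W} {α β : B → ℝ} (hα : cs.IsRootOf unitLengths t α)
    (hβ : cs.IsRootOf unitLengths t β) : α = β ∨ α = -β := by
  obtain ⟨k, rfl⟩ := cs.exists_eq_smul_of_isRootOf _ hα hβ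
  have hone : ∀ {γ}, cs.IsRootOf unitLengths t γ → M.rootForm unitLengths γ γ = 1 := by
    rintro _ ⟨w, i, -, rfl⟩
    rw [rootForm_geomRep, rootForm_simpleRoot_self]
    simp [unitLengths]
  have h1 := hone hβ
  rw [map_smul, map_smul, LinearMap.smul_apply, hone hα, smul_eq_mul, smul_eq_mul, mul_one,
    mul_self_eq_one_iff] at h1
  rcases h1 with rfl | rfl
  · simp
  · simp

theorem IsCrystallographic.eq_or_eq_neg_of_isRootOf {d : B → Set.Ioi (0 : ℝ)}
    (hd : cs.IsCrystallographic d) {t : W} {α β : B → ℝ}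
    (hα : cs.IsRootOf d t α) (hβ : cs.IsRootOf d t β) : α = β ∨ α = -β := by
  obtain ⟨k, rfl⟩ := cs.exists_eq_smul_of_isRootOf _ hα hβ
  have hroot : ∀ {γ}, cs.IsRootOf d t γ → γ ∈ cs.roots d := by
    rintro _ ⟨w, i, -, rfl⟩
    exact ⟨w, i, rfl⟩
  rcases hd.reduced α (hroot hα) k (hroot hβ) with rfl | rfl
  · simp
  · simp

/-- This makes the coefficient of `α_i` in `s_i(α_j)` nonzero along an edge. -/
theorem simpleCoroot_simpleRoot_neg {i j : B} (hij : i ≠ j) (hM : M i j ≠ 2) :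
    M.simpleCoroot d i (simpleRoot j) < 0 := by
  have h1 : M i j ≠ 1 := M.off_diagonal i j hij
  have hi : (0 : ℝ) < d i := (d i).2
  have hj : (0 : ℝ) < d j := (d j).2
  have hcos : 0 < Real.cos (Real.pi / M i j) := by
    rcases Nat.eq_zero_or_pos (M i j) with h0 | h0
    -- The entry `0` encodes `∞`; division by zero gives the angle `0`, with cosine `1`.
    · simp [h0]
    · have h3 : (3 : ℝ) ≤ M i j := by exact_mod_cast (by omega : 3 ≤ M i j)
      apply Real.cos_pos_of_mem_Ioo
      constructor
      · have : 0 < Real.pi / M i j := div_pos Real.pi_pos (by linarith)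
        linarith [Real.pi_pos]
      · exact div_lt_div_of_pos_left Real.pi_pos two_pos (by linarith)
  rw [simpleCoroot_simpleRoot]
  have : 0 < 2 * ((d j : ℝ) / d i) * Real.cos (Real.pi / M i j) := by positivity
  linarith

end Moved

end CoxeterSystem

/-! ### Automorphisms of order complexes and of bounded posets -/

section OrderComplex

variable {P : Type*} [PartialOrder P] [BoundedOrder P]

theorem properPerm_mem_typePreservingAut {type : P → ℕ} (φ : P ≃o P)
    (hφ : ∀ x, type (φ x) = type x) :
    properPerm φ ∈ typePreservingAut (orderComplex P) fun x => type x.1 := by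
  refine ⟨fun s => ?_, fun v => hφ v.1⟩
  change (_ ∧ _) ↔ (_ ∧ _)
  rw [Finset.map_nonempty]
  refine and_congr_right fun _ => ?_
  rw [Finset.coe_map]
  have hle : ∀ x y : ProperPart P, properPerm φ x ≤ properPerm φ y ↔ x ≤ y := fun x y =>
    φ.le_iff_le
  constructor
  · intro h x hx y hy hxy
    have := h (Set.mem_image_of_mem _ hx) (Set.mem_image_of_mem _ hy)
      (fun h => hxy ((properPerm φ).injective h))
    simpa only [Equiv.coe_toEmbedding, hle] using this
  · rintro h _ ⟨x, hx, rfl⟩ _ ⟨y, hy, rfl⟩ hxy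
    simpa only [Equiv.coe_toEmbedding, hle] using h hx hy fun h => hxy (by rw [h])

/-- The image of the simplex `{x, y}` is a chain, and the preserved types decide its direction. -/
theorem le_of_mem_typePreservingAut {type : ProperPart P → ℕ} (htype : StrictMono type)
    {Θ : Equiv.Perm (ProperPart P)} (hΘ : Θ ∈ typePreservingAut (orderComplex P) type)
    {x y : ProperPart P} (hxy : x ≤ y) : Θ x ≤ Θ y := by
  classical
  have hface : ({x, y} : Finset (ProperPart P)) ∈ (orderComplex P).faces := by
    refine ⟨by simp, ?_⟩
    rw [Finset.coe_pair]
    exact IsChain.pair hxy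
  obtain ⟨-, hchain⟩ := (hΘ.1 _).2 hface
  rcases hchain.total (x := Θ x) (y := Θ y) (by simp) (by simp) with h | h
  · exact h
  · rcases h.eq_or_lt with h | h
    · exact h.ge
    · have := htype h
      rw [hΘ.2, hΘ.2] at this
      exact absurd (htype.monotone hxy) (not_le.2 this)

/-- Type-preserving automorphisms of the order complex come from automorphisms of the poset. -/
theorem exists_properPerm_eq {type : ProperPart P → ℕ} (htype : StrictMono type)
    {Θ : Equiv.Perm (ProperPart P)} (hΘ : Θ ∈ typePreservingAut (orderComplex P) type) :
    ∃ Ψ : P ≃o P, properPerm Ψ = Θ := by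
  classical
  -- `Equiv.Perm.ofSubtype` extends `Θ` by fixing `⊥` and `⊤`.
  have mono : ∀ {Θ : Equiv.Perm (ProperPart P)}, Θ ∈ typePreservingAut (orderComplex P) type →
      ∀ {x y : P}, x ≤ y → Equiv.Perm.ofSubtype Θ x ≤ Equiv.Perm.ofSubtype Θ y := by
    intro Θ hΘ x y hxy
    by_cases hx : x ≠ ⊥ ∧ x ≠ ⊤
    · by_cases hy : y ≠ ⊥ ∧ y ≠ ⊤
      · rw [Equiv.Perm.ofSubtype_apply_of_mem Θ hx, Equiv.Perm.ofSubtype_apply_of_mem Θ hy]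
        exact le_of_mem_typePreservingAut htype hΘ (x := ⟨x, hx⟩) (y := ⟨y, hy⟩) hxy
      · rw [Equiv.Perm.ofSubtype_apply_of_not_mem Θ hy]
        have : y = ⊤ := by
          by_contra h
          refine hy ⟨fun h' => hx.1 (le_bot_iff.1 (h' ▸ hxy)), h⟩
        rw [this]
        exact le_top
    · rw [Equiv.Perm.ofSubtype_apply_of_not_mem Θ hx]
      by_cases hx0 : x = ⊥
      · rw [hx0]
        exact bot_le
      · have hx1 : x = ⊤ := by
          by_contra h
          exact hx ⟨hx0, h⟩
        subst hx1
        obtain rfl : y = ⊤ := top_le_iff.1 hxy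
        rw [Equiv.Perm.ofSubtype_apply_of_not_mem Θ hx]
  refine ⟨⟨Equiv.Perm.ofSubtype Θ, fun {x y} => ⟨fun h => ?_, mono hΘ⟩⟩, ?_⟩
  · have := mono (inv_mem hΘ) h
    have hinv : ∀ x, Equiv.Perm.ofSubtype Θ⁻¹ (Equiv.Perm.ofSubtype Θ x) = x := fun x => by
      rw [← Equiv.Perm.mul_apply, ← map_mul, inv_mul_cancel, map_one, Equiv.Perm.one_apply]
    exact hinv x ▸ hinv y ▸ this
  · ext x
    exact Equiv.Perm.ofSubtype_apply_of_mem Θ x.2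

end OrderComplex

namespace CoxeterSystem

/-! ### Unique extension along an equivariant map -/

section Abstract

variable {B : Type*} {W : Type*} [Fintype B] [DecidableEq B] [Group W] {M : CoxeterMatrix B}
  (cs : CoxeterSystem M W) {K : Type*} [Field K]

theorem inducedAut_apply {V : Type*} [AddCommGroup V] [Module K V] (ψ : V ≃ₗ[K] V)
    (U : Submodule K V) : inducedAut ψ U = U.map (ψ : V →ₗ[K] V) := rfl

/-- A map from a finite Coxeter group to the subspaces of `K ^ B` that is equivariant and behaves
like the map to the moved spaces. -/
structure IsMovedMap (F : W → Submodule K (B → K)) (IsRoot : W → (B → K) → Prop)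
    (ρ : W → (B → K) ≃ₗ[K] (B → K)) : Prop where
  conj : ∀ g w, F (g * w * g⁻¹) = (F w).map (ρ g : (B → K) →ₗ[K] (B → K))
  inv : ∀ w, F w⁻¹ = F w
  one : F 1 = ⊥
  coxeterElement : ∀ c, cs.IsCoxeterElement c → F c = ⊤
  eq_one : ∀ c, cs.IsCoxeterElement c → ∀ w, cs.AbsLE w c → F w = ⊥ → w = 1
  eq_coxeterElement : ∀ c, cs.IsCoxeterElement c → ∀ w, cs.AbsLE w c → F w = ⊤ → w = c
  root : ∀ g t α, IsRoot t α → IsRoot (g * t * g⁻¹) (ρ g α)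
  root_unique : ∀ t α β, IsRoot t α → IsRoot t β → α = β ∨ α = -β
  simple : ∀ i, F (cs.simple i) = Submodule.span K {Pi.single i 1}
  edge : ∀ i j, i ≠ j → M i j ≠ 2 → ∃ a b : K, a ≠ 0 ∧ b ≠ 0 ∧
    F (cs.simple i * cs.simple j * (cs.simple i)⁻¹) =
      Submodule.span K {Pi.single i a + Pi.single j b}

variable {cs} {F : W → Submodule K (B → K)} {IsRoot : W → (B → K) → Prop}
  {ρ : W → (B → K) ≃ₗ[K] (B → K)}

/-- The restriction of a lattice automorphism to the non-crossing partitions determines it. -/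
theorem IsMovedMap.eq_refl [Finite W] (hF : cs.IsMovedMap F IsRoot ρ) {ω : List B} (hω : ω.Nodup)
    (hω' : ∀ i, i ∈ ω) (hM : M.IsIrreducible) {Ψ : Submodule K (B → K) ≃o Submodule K (B → K)}
    (hΨ : ∀ w, cs.AbsLE w (cs.wordProd ω) → Ψ (F w) = F w)
    (h : (∃ χ : (B → K) ≃ₗ[K] (B → K), ∀ U, Ψ U = U.map (χ : (B → K) →ₗ[K] (B → K))) ∨
      (Subsingleton (K →+* K) ∧ Fintype.card B ≠ 2)) : Ψ = OrderIso.refl _ := by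
  have hc : cs.IsCoxeterElement (cs.wordProd ω) := ⟨ω, hω, hω', IsConj.refl _⟩
  have hlen : ω.length = cs.absLength (cs.wordProd ω) := by
    rw [cs.absLength_coxeterElement hc, ← List.toFinset_card_of_nodup hω]
    congr 1
    ext i
    simp [hω']
  have h1 : ∀ i, Ψ (Submodule.span K {Pi.single i 1}) = Submodule.span K {Pi.single i 1} := by
    intro i
    rw [← hF.simple i]
    exact hΨ _ (cs.simple_absLE rfl hlen (hω' i))
  have h2 : ∀ i j, (SimpleGraph.fromRel fun i j : B => M i j ≠ 2).Adj i j →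
      ∃ a b : K, a ≠ 0 ∧ b ≠ 0 ∧ Ψ (Submodule.span K {Pi.single i a + Pi.single j b}) =
        Submodule.span K {Pi.single i a + Pi.single j b} := by
    intro i j hij
    rw [SimpleGraph.fromRel_adj, M.symmetric j i, or_self] at hij
    rcases cs.simple_conj_absLE rfl hlen (hω' i) (hω' j) hij.1 with h | h
    · obtain ⟨a, b, ha, hb, hab⟩ := hF.edge i j hij.1 hij.2
      exact ⟨a, b, ha, hb, by rw [← hab]; exact hΨ _ h⟩
    · obtain ⟨a, b, ha, hb, hab⟩ := hF.edge j i hij.1.symm (by rw [M.symmetric]; exact hij.2)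
      exact ⟨b, a, hb, ha, by rw [add_comm, ← hab]; exact hΨ _ h⟩
  rcases h with ⟨χ, hχ⟩ | ⟨_, hB⟩
  · exact SubspaceLattice.eq_refl_of_fixes_of_linear hM h1 h2 χ hχ
  · exact SubspaceLattice.eq_refl_of_fixes hM h1 h2 hB

theorem IsMovedMap.eq_inducedAut [Finite W] (hF : cs.IsMovedMap F IsRoot ρ) {c : W}
    (hc : cs.IsCoxeterElement c) (hM : M.IsIrreducible) {φ : cs.NC c ≃o cs.NC c}
    {ψ : (B → K) ≃ₗ[K] (B → K)} (hψ : ExtendsAlong (fun w => F w.val) φ (inducedAut ψ))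
    {Ψ : Submodule K (B → K) ≃o Submodule K (B → K)}
    (hΨ : ExtendsAlong (fun w => F w.val) φ Ψ)
    (h : (∃ χ : (B → K) ≃ₗ[K] (B → K), Ψ = inducedAut χ) ∨
      (Subsingleton (K →+* K) ∧ Fintype.card B ≠ 2)) : Ψ = inducedAut ψ := by
  obtain ⟨ω, hω, hω', hconj⟩ := hc
  obtain ⟨k, rfl⟩ := isConj_iff.1 hconj
  -- `X` is `ψ⁻¹ Ψ` conjugated by `ρ k`, which replaces `c` by the product of simple reflections
  -- `ω`.
  let X := (inducedAut (ρ k)).trans (Ψ.trans ((inducedAut ψ).symm.trans (inducedAut (ρ k)).symm))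
  have hX : X = OrderIso.refl _ := by
    refine hF.eq_refl hω hω' hM (fun w hw => ?_) (h.imp_left ?_)
    · have e1 : inducedAut (ρ k) (F w) = F (k * w * k⁻¹) := (hF.conj k w).symm
      have e2 := hΨ ⟨k * w * k⁻¹, AbsLE.conj cs hw k⟩
      have e3 := hψ ⟨k * w * k⁻¹, AbsLE.conj cs hw k⟩
      change (inducedAut (ρ k)).symm ((inducedAut ψ).symm (Ψ (inducedAut (ρ k) (F w)))) = F w
      rw [OrderIso.symm_apply_eq, OrderIso.symm_apply_eq, e1]
      exact e2.trans e3.symm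
    · rintro ⟨χ, rfl⟩
      refine ⟨(ρ k).trans (χ.trans (ψ.symm.trans (ρ k).symm)), fun U => ?_⟩
      change (inducedAut (ρ k)).symm ((inducedAut ψ).symm (inducedAut χ (inducedAut (ρ k) U))) = _
      rw [OrderIso.symm_apply_eq, OrderIso.symm_apply_eq]
      simp only [inducedAut_apply, ← Submodule.map_comp]
      congr 1
      exact LinearMap.ext fun v => by simp
  refine OrderIso.ext (funext fun U => ?_)
  have := DFunLike.congr_fun hX ((inducedAut (ρ k)).symm U)
  change (inducedAut (ρ k)).symm ((inducedAut ψ).symm (Ψ (inducedAut (ρ k)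
    ((inducedAut (ρ k)).symm U)))) = (inducedAut (ρ k)).symm U at this
  rwa [OrderIso.apply_symm_apply, (inducedAut (ρ k)).symm.injective.eq_iff,
    OrderIso.symm_apply_eq] at this

/-- The extension is `ρ g`, where `φ` is conjugation by `g` up to inversion. -/
theorem IsMovedMap.extendsUniquely [Finite W] [Subsingleton (K →+* K)]
    (hF : cs.IsMovedMap F IsRoot ρ) {c l r : W} (hc : cs.IsCoxeterElement c)
    (h : IsBipartition c l r) {φ : cs.NC c ≃o cs.NC c} (hφ : φ ∈ cs.dihedralAut h) :
    cs.ExtendsUniquely (fun w => F w.val) IsRoot φ := by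
  obtain ⟨g, hg⟩ := cs.exists_conj_of_mem_dihedralAut h hφ
  have hlen : ∀ w, cs.absLength (φ w).val = cs.absLength w.val := by
    intro w
    rcases hg with hg | hg
    · rw [hg, absLength_conj]
    · rw [hg, absLength_conj, absLength_inv]
  have hext : ExtendsAlong (fun w : cs.NC c => F w.val) φ (inducedAut (ρ g)) := by
    intro w
    change inducedAut (ρ g) (F w.val) = F (φ w).val
    rcases hg with hg | hg
    · rw [hg, hF.conj]
      rfl
    · rw [hg, hF.conj, hF.inv]
      rfl
  have hproper : ∀ w : cs.NC c, w ≠ ⊥ ∧ w ≠ ⊤ → F w.val ≠ ⊥ ∧ F w.val ≠ ⊤ := fun w hw =>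
    ⟨fun h => hw.1 (NC.ext (hF.eq_one c hc _ w.absLE h)),
      fun h => hw.2 (NC.ext (hF.eq_coxeterElement c hc _ w.absLE h))⟩
  have hbuilding : ∀ ψ : (B → K) ≃ₗ[K] (B → K), properPerm (inducedAut ψ) ∈ buildingAut K (B → K) :=
    fun ψ => properPerm_mem_typePreservingAut (type := fun U : Submodule K (B → K) =>
      Module.finrank K U) _ fun U => LinearEquiv.finrank_map_eq ψ U
  refine ⟨properPerm_mem_typePreservingAut (type := fun w : cs.NC c => cs.absLength w.val) φ hlen,
    ρ g, ?_, hext, hbuilding _, fun x => ⟨hproper x.1 x.2, hext x.1⟩, ?_, ?_⟩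
  · intro t ht α β hα hβ
    -- Reflections are involutions, so the possible inversion has no effect.
    have hφt : (φ t).val = g * t.val * g⁻¹ := by
      rcases hg with hg | hg
      · exact hg t
      · rw [hg, ht.inv]
    exact hF.root_unique _ _ _ (hφt ▸ hF.root g _ _ hα) hβ
  · intro hM ψ' hψ'
    exact hF.eq_inducedAut hc hM hext hψ' (Or.inl ⟨ψ', rfl⟩)
  · intro hM hn
    rw [Module.finrank_fintype_fun_eq_card] at hn
    have huniq : ∀ Ψ : Submodule K (B → K) ≃o Submodule K (B → K),
        ExtendsAlong (fun w : cs.NC c => F w.val) φ Ψ → Ψ = inducedAut (ρ g) := fun Ψ hΨ =>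
      hF.eq_inducedAut hc hM hext hΨ (Or.inr ⟨inferInstance, hn⟩)
    refine ⟨huniq, fun Θ hΘ hΘ' => ?_⟩
    obtain ⟨Ψ, rfl⟩ := exists_properPerm_eq
      (fun U U' hU => Submodule.finrank_lt_finrank_of_lt hU) hΘ
    rw [huniq Ψ fun w => ?_]
    -- The simplicial condition says nothing about `⊥` and `⊤`, but `F` preserves both.
    have hbot : F (⊥ : cs.NC c).val = ⊥ := hF.one
    have htop : F (⊤ : cs.NC c).val = ⊤ := hF.coxeterElement c hc
    by_cases hw : w ≠ ⊥ ∧ w ≠ ⊤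
    · obtain ⟨_, hx⟩ := hΘ' ⟨w, hw⟩
      exact hx
    · by_cases hw0 : w = ⊥
      · simp only [hw0, map_bot, hbot]
      · have hw1 : w = ⊤ := by
          by_contra h1
          exact hw ⟨hw0, h1⟩
        simp only [hw1, map_top, htop]

end Abstract

end CoxeterSystem

namespace CoxeterSystem

/-! ### Moved spaces over the real numbers -/

section RealCase

variable {B : Type*} {W : Type*} [Fintype B] [DecidableEq B] [Group W] {M : CoxeterMatrix B}
  (cs : CoxeterSystem M W)

theorem moved_simple_conj_simple (d : B → Set.Ioi (0 : ℝ)) (i j : B) :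
    cs.moved d (cs.simple i * cs.simple j * (cs.simple i)⁻¹) =
      Submodule.span ℝ {Pi.single i (-M.simpleCoroot d i (simpleRoot j)) + Pi.single j 1} := by
  rw [cs.moved_eq_span_of_isRootOf d ⟨cs.simple i, j, rfl, rfl⟩, geomRep_simple_apply]
  congr 2
  rw [sub_eq_neg_add, ← neg_smul, simpleRoot, simpleRoot, ← Pi.single_smul, smul_eq_mul, mul_one]

theorem isMovedMap_moved [Finite W] :
    cs.IsMovedMap (cs.moved unitLengths) (cs.IsRootOf unitLengths) (cs.geomRep unitLengths) where
  conj := cs.moved_conj _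
  inv := cs.moved_inv _
  one := cs.moved_one _
  coxeterElement _ hc := cs.moved_coxeterElement _ hc
  eq_one _ hc _ hw h := cs.eq_one_of_moved_eq_bot _ hc hw h
  eq_coxeterElement _ hc _ hw h := cs.eq_of_moved_eq_top _ hc hw h
  root g _ _ h := IsRootOf.geomRep cs _ h g
  root_unique _ _ _ hα hβ := cs.eq_or_eq_neg_of_isRootOf hα hβ
  simple := cs.moved_simple _
  edge i j hij hM := ⟨_, _, neg_ne_zero.2 (simpleCoroot_simpleRoot_neg _ hij hM).ne, one_ne_zero,
    cs.moved_simple_conj_simple _ i j⟩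

end RealCase

/-! ### Reduction modulo a prime -/

section Vectors

variable {B : Type*}

theorem intVec_apply (v : B → ℤ) (i : B) : intVec v i = v i := rfl

theorem reduceMod_apply (p : ℕ) (v : B → ℤ) (i : B) : reduceMod p v i = v i := rfl

theorem intVec_injective : Function.Injective (intVec : (B → ℤ) →+ (B → ℝ)) := fun _ _ h =>
  funext fun i => Int.cast_injective (congrFun h i)

theorem reduceMod_surjective (p : ℕ) : Function.Surjective (reduceMod p : (B → ℤ) →+ _) := by
  intro v
  choose u hu using fun i => ZMod.intCast_surjective (v i)
  exact ⟨u, funext hu⟩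

variable [DecidableEq B]

theorem intVec_single (i : B) (a : ℤ) : intVec (Pi.single i a) = Pi.single i (a : ℝ) := by
  ext j
  by_cases h : j = i
  · subst h; simp [intVec_apply]
  · simp [intVec_apply, h]

theorem reduceMod_single (p : ℕ) (i : B) (a : ℤ) :
    reduceMod p (Pi.single i a) = Pi.single i (a : ZMod p) := by
  ext j
  by_cases h : j = i
  · subst h; simp [reduceMod_apply]
  · simp [reduceMod_apply, h]

end Vectors

section Reduction

variable {B : Type*} {W : Type*} [Fintype B] [DecidableEq B] [Group W] {M : CoxeterMatrix B}
  {cs : CoxeterSystem M W} {d : B → Set.Ioi (0 : ℝ)}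

theorem IsCrystallographic.exists_cartan (hd : cs.IsCrystallographic d) :
    ∃ A : B → B → ℤ, ∀ i j, M.simpleCoroot d i (simpleRoot j) = A i j := by
  have hroot : ∀ i, simpleRoot i ∈ cs.roots d := fun i => ⟨1, i, by simp⟩
  have key : ∀ i j, ∃ n : ℤ, M.simpleCoroot d i (simpleRoot j) = n := by
    intro i j
    obtain ⟨n, hn⟩ := hd.integral _ (hroot j) _ (hroot i)
    refine ⟨n, ?_⟩
    rw [← hn, simpleCoroot_simpleRoot, rootForm_simpleRoot_self, rootForm_simpleRoot,
      M.symmetric j i]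
    have hi : (d i : ℝ) ≠ 0 := (d i).2.ne'
    field_simp
  choose A hA using key
  exact ⟨A, hA⟩

/-- The action of the group restricts to the integer vectors and descends to the vectors
modulo `p`. -/
theorem IsCrystallographic.exists_reduction (hd : cs.IsCrystallographic d) (p : ℕ) (g : W) :
    ∃ (N : (B → ℤ) ≃+ (B → ℤ)) (ψ : (B → ZMod p) ≃ₗ[ZMod p] (B → ZMod p)),
      (∀ v, intVec (N v) = cs.geomRep d g (intVec v)) ∧
        ∀ v, reduceMod p (N v) = ψ (reduceMod p v) := by
  obtain ⟨A, hA⟩ := hd.exists_cartan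
  induction g using cs.simple_induction with
  | simple i =>
    have hAi : A i i = 2 := by
      have := hA i i
      rw [simpleCoroot_self] at this
      exact_mod_cast this.symm
    -- The same Cartan integers define the simple reflection over `ℤ` and over `𝔽_p`.
    let f : Module.Dual ℤ (B → ℤ) := ∑ j, A i j • LinearMap.proj j
    let fp : Module.Dual (ZMod p) (B → ZMod p) := ∑ j, (A i j : ZMod p) • LinearMap.proj j
    have hf : f (Pi.single i 1) = 2 := by simp [f, Pi.single_apply, hAi]
    have hfp : fp (Pi.single i 1) = 2 := by simp [fp, Pi.single_apply, hAi]
    refine ⟨(Module.reflection hf).toAddEquiv, Module.reflection hfp, fun v => ?_, fun v => ?_⟩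
    · have h1 : M.simpleCoroot d i (intVec v) = (f v : ℤ) := by
        have : intVec v = ∑ j, (v j : ℝ) • simpleRoot j := by
          ext k
          simp [simpleRoot, Pi.single_apply, intVec_apply]
        rw [this, map_sum]
        simp [f, hA, mul_comm]
      rw [geomRep_simple_apply, h1]
      change intVec (Module.reflection hf v) = _
      rw [Module.reflection_apply, map_sub, simpleRoot, ← Pi.single_smul, ← Pi.single_smul,
        intVec_single]
      simp
    · have h1 : fp (reduceMod p v) = (f v : ℤ) := by
        simp [f, fp, reduceMod_apply]
      change reduceMod p (Module.reflection hf v) = _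
      rw [Module.reflection_apply, Module.reflection_apply, h1, map_sub, ← Pi.single_smul,
        ← Pi.single_smul, reduceMod_single]
      simp
  | one => exact ⟨AddEquiv.refl _, LinearEquiv.refl _ _, fun v => by simp, fun v => rfl⟩
  | mul g g' h h' =>
    obtain ⟨N, ψ, h1, h2⟩ := h
    obtain ⟨N', ψ', h1', h2'⟩ := h'
    refine ⟨N'.trans N, ψ'.trans ψ, fun v => ?_, fun v => ?_⟩
    · rw [AddEquiv.trans_apply, h1, h1', geomRep_mul_apply]
    · rw [AddEquiv.trans_apply, h2, h2', LinearEquiv.trans_apply]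

/-! ### Moved spaces modulo a prime -/

section ModMoved

variable (cs d) (p : ℕ)

theorem mem_modMoved {w : W} {x : B → ZMod p} :
    x ∈ cs.modMoved d p w ↔ ∃ u, intVec u ∈ cs.moved d w ∧ reduceMod p u = x := by
  rw [modMoved, AddSubgroup.mem_toZModSubmodule, AddSubgroup.mem_map]
  rfl

theorem modMoved_inv (w : W) : cs.modMoved d p w⁻¹ = cs.modMoved d p w := by
  ext x
  rw [mem_modMoved, mem_modMoved, moved_inv]

theorem modMoved_eq_bot {w : W} (h : cs.moved d w = ⊥) : cs.modMoved d p w = ⊥ := by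
  rw [eq_bot_iff]
  intro x hx
  obtain ⟨u, hu, rfl⟩ := (cs.mem_modMoved d p).1 hx
  rw [h, Submodule.mem_bot, ← map_zero intVec] at hu
  rw [intVec_injective hu, map_zero]
  exact Submodule.zero_mem _

theorem modMoved_eq_top {w : W} (h : cs.moved d w = ⊤) : cs.modMoved d p w = ⊤ := by
  rw [eq_top_iff]
  intro x _
  obtain ⟨u, rfl⟩ := reduceMod_surjective p x
  exact (cs.mem_modMoved d p).2 ⟨u, h ▸ Submodule.mem_top, rfl⟩

/-- Integral moved vectors lifting the standard basis form a matrix with determinant `1` modulo `p`,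
hence nonzero; they span the real space. -/
theorem moved_eq_top_of_modMoved_eq_top [Fact p.Prime] {w : W} (h : cs.modMoved d p w = ⊤) :
    cs.moved d w = ⊤ := by
  have hex : ∀ i : B, ∃ u, intVec u ∈ cs.moved d w ∧ reduceMod p u = Pi.single i 1 := fun i =>
    (cs.mem_modMoved d p).1 (h ▸ Submodule.mem_top)
  choose u hu hred using hex
  let U : Matrix B B ℤ := Matrix.of u
  have hdet : U.det ≠ 0 := by
    intro h0
    have h1 : (Int.castRingHom (ZMod p)).mapMatrix U = 1 := by
      ext i j
      have := congrFun (hred i) j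
      rw [reduceMod_apply] at this
      simp [U, Matrix.one_apply, this, Pi.single_apply, eq_comm]
    have h2 := RingHom.map_det (Int.castRingHom (ZMod p)) U
    rw [h1, h0, map_zero, Matrix.det_one] at h2
    exact zero_ne_one h2
  have hdet' : IsUnit ((Int.castRingHom ℝ).mapMatrix U) := by
    rw [Matrix.isUnit_iff_isUnit_det, ← RingHom.map_det, isUnit_iff_ne_zero]
    exact Int.cast_ne_zero.2 hdet
  have hli := Matrix.linearIndependent_rows_iff_isUnit.2 hdet'
  rw [eq_top_iff, ← hli.span_eq_top_of_card_eq_finrank' (by simp), Submodule.span_le]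
  rintro _ ⟨i, rfl⟩
  exact hu i

theorem modMoved_simple (i : B) :
    cs.modMoved d p (cs.simple i) = Submodule.span (ZMod p) {Pi.single i 1} := by
  ext x
  rw [mem_modMoved, Submodule.mem_span_singleton, moved_simple]
  constructor
  · rintro ⟨u, hu, rfl⟩
    obtain ⟨a, ha⟩ := Submodule.mem_span_singleton.1 hu
    refine ⟨u i, ?_⟩
    ext j
    by_cases hj : j = i
    · subst hj
      simp [reduceMod_apply]
    · have := congrFun ha j
      simp only [simpleRoot, Pi.smul_apply, Pi.single_eq_of_ne hj, smul_zero, intVec_apply] at this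
      have : u j = 0 := by exact_mod_cast this.symm
      simp [hj, reduceMod_apply, this]
  · rintro ⟨a, rfl⟩
    obtain ⟨n, rfl⟩ := ZMod.intCast_surjective a
    refine ⟨Pi.single i n, Submodule.mem_span_singleton.2 ⟨n, ?_⟩, ?_⟩
    · rw [intVec_single, simpleRoot, ← Pi.single_smul, smul_eq_mul, mul_one]
    · rw [reduceMod_single, ← Pi.single_smul, smul_eq_mul, mul_one]

end ModMoved

/-- Every integral moved vector is divisible by `p`, and the quotient is again moved, so the vector
is zero by infinite descent. As `w` acts integrally, it fixes every simple root. -/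
theorem IsCrystallographic.moved_eq_bot (hd : cs.IsCrystallographic d) (p : ℕ) [Fact p.Prime]
    {w : W} (h : cs.modMoved d p w = ⊥) : cs.moved d w = ⊥ := by
  have hp := (Fact.out : p.Prime)
  have hdvd : ∀ k u, intVec u ∈ cs.moved d w → ∀ i, (p : ℤ) ^ k ∣ u i := by
    intro k
    induction k with
    | zero => simp
    | succ k ih =>
      intro u hu i
      have hu0 : reduceMod p u = 0 := by
        rw [← Submodule.mem_bot (ZMod p), ← h]
        exact (cs.mem_modMoved d p).2 ⟨u, hu, rfl⟩
      have hex : ∀ j, ∃ a, u j = p * a := fun j =>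
        (ZMod.intCast_zmod_eq_zero_iff_dvd _ _).1 (congrFun hu0 j)
      choose v hv using hex
      have hv' : intVec v = (p : ℝ)⁻¹ • intVec u := by
        ext j
        have : (p : ℝ) ≠ 0 := by exact_mod_cast hp.ne_zero
        simp [intVec_apply, hv, this]
      rw [hv, pow_succ']
      exact mul_dvd_mul_left _ (ih v (hv' ▸ Submodule.smul_mem _ _ hu) i)
  have hzero : ∀ u, intVec u ∈ cs.moved d w → u = 0 := by
    intro u hu
    ext i
    -- The exponent `|u_i|` suffices because `|u_i| < p ^ |u_i|`.
    refine Int.eq_zero_of_abs_lt_dvd (hdvd (u i).natAbs u hu i) ?_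
    rw [Int.abs_eq_natAbs]
    exact_mod_cast Nat.lt_pow_self hp.one_lt
  obtain ⟨N, -, hN, -⟩ := hd.exists_reduction p w
  have hfix : (cs.geomRep d w : (B → ℝ) →ₗ[ℝ] (B → ℝ)) = LinearMap.id := by
    refine (Pi.basisFun ℝ B).ext fun i => ?_
    have h1 := hzero (N (Pi.single i 1) - Pi.single i 1)
      ((cs.mem_moved d).2 ⟨intVec (Pi.single i 1), by rw [map_sub, hN]⟩)
    have h2 := hN (Pi.single i 1)
    rw [sub_eq_zero.1 h1, intVec_single, Int.cast_one] at h2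
    simpa using h2.symm
  rw [moved, hfix, sub_self, LinearMap.range_zero]

/-- Replacing `α_i` by `s_i(α_j) = α_j - a α_i` in the simple basis gives a basis of positive roots.
If `p` divided `a`, two of its members would reduce to the same vector. Compatibility is used only
here. -/
theorem IsCompatible.cartan_ne_zero {p : ℕ} [Fact p.Prime] (hp : cs.IsCompatible d p) {i j : B}
    (hij : i ≠ j) (hM : M i j ≠ 2) {a : ℤ} (ha : M.simpleCoroot d i (simpleRoot j) = a) :
    (a : ZMod p) ≠ 0 := by
  intro h0
  have hneg := simpleCoroot_simpleRoot_neg d hij hM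
  have ha0 : (a : ℝ) ≠ 0 := ha ▸ hneg.ne
  have haneg : a < 0 := by
    rw [ha] at hneg
    exact_mod_cast hneg
  let b : B → (B → ℤ) := fun k => if k = i then Pi.single j 1 - Pi.single i a else Pi.single k 1
  have hbi : b i = Pi.single j 1 - Pi.single i a := if_pos rfl
  have hbk : ∀ k, k ≠ i → b k = Pi.single k 1 := fun k hk => if_neg hk
  have hpos : ∀ k, intVec (b k) ∈ cs.posRoots d := by
    intro k
    by_cases hk : k = i
    · subst hk
      rw [hbi, map_sub, intVec_single, intVec_single]
      refine ⟨⟨cs.simple k, j, ?_⟩, fun l => ?_⟩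
      · rw [geomRep_simple_apply, ha, simpleRoot, simpleRoot, ← Pi.single_smul]
        simp
      · have h1 : 0 ≤ (Pi.single j ((1 : ℤ) : ℝ) : B → ℝ) l := by
          by_cases h : l = j
          · subst h; simp
          · simp [h]
        have h2 : (Pi.single k (a : ℝ) : B → ℝ) l ≤ 0 := by
          by_cases h : l = k
          · subst h
            rw [Pi.single_eq_same]
            exact_mod_cast haneg.le
          · simp [h]
        rw [Pi.sub_apply]
        linarith
    · rw [hbk k hk, intVec_single]
      refine ⟨⟨1, k, by simp [simpleRoot]⟩, fun l => ?_⟩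
      by_cases h : l = k
      · subst h; simp
      · simp [h]
  have hspan : Submodule.span ℝ (Set.range fun k => intVec (b k)) = ⊤ := by
    rw [eq_top_iff, ← (Pi.basisFun ℝ B).span_eq, Submodule.span_le]
    have hmem : ∀ k, intVec (b k) ∈ Submodule.span ℝ (Set.range fun k => intVec (b k)) := fun k =>
      Submodule.subset_span ⟨k, rfl⟩
    rintro _ ⟨k, rfl⟩
    rw [Pi.basisFun_apply, SetLike.mem_coe]
    by_cases hk : k = i
    · have : (Pi.single k 1 : B → ℝ) = (a : ℝ)⁻¹ • (intVec (b j) - intVec (b i)) := by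
        rw [hbi, hbk j hij.symm, map_sub, intVec_single, intVec_single, sub_sub_cancel,
          ← Pi.single_smul, smul_eq_mul, inv_mul_cancel₀ ha0, hk]
      rw [this]
      exact Submodule.smul_mem _ _ (Submodule.sub_mem _ (hmem j) (hmem i))
    · have := hmem k
      rwa [hbk k hk, intVec_single, Int.cast_one] at this
  have hli : LinearIndependent ℝ fun k => intVec (b k) :=
    linearIndependent_of_top_le_span_of_card_eq_finrank hspan.ge (by simp)
  refine hij ((hp b hpos hli hspan).1.injective ?_)
  simp only [hbi, hbk j hij.symm, map_sub, reduceMod_single, h0, Pi.single_zero, sub_zero]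

theorem IsCrystallographic.exists_isMovedMap [Finite W] (hd : cs.IsCrystallographic d) {p : ℕ}
    [Fact p.Prime] (hp : cs.IsCompatible d p) :
    ∃ ρ, cs.IsMovedMap (cs.modMoved d p) (cs.IsModRootOf d p) ρ := by
  choose N ρ hN hρ using hd.exists_reduction p
  have hconj : ∀ g w, cs.modMoved d p (g * w * g⁻¹) =
      (cs.modMoved d p w).map (ρ g : (B → ZMod p) →ₗ[ZMod p] (B → ZMod p)) := by
    intro g w
    ext x
    rw [mem_modMoved, Submodule.mem_map, moved_conj]
    constructor
    · rintro ⟨u, hu, rfl⟩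
      obtain ⟨y, hy, hyu⟩ := Submodule.mem_map.1 hu
      -- As `g` permutes the integer vectors, an integral vector in the moved space of the conjugate
      -- comes from an integral one in that of `w`.
      obtain ⟨u, rfl⟩ := (N g).surjective u
      rw [hN] at hyu
      rw [(cs.geomRep d g).injective hyu] at hy
      exact ⟨_, (cs.mem_modMoved d p).2 ⟨u, hy, rfl⟩, (hρ g u).symm⟩
    · rintro ⟨y, hy, rfl⟩
      obtain ⟨u, hu, rfl⟩ := (cs.mem_modMoved d p).1 hy
      exact ⟨N g u, by rw [hN]; exact Submodule.mem_map_of_mem hu, hρ g u⟩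
  refine ⟨ρ, hconj, cs.modMoved_inv d p, cs.modMoved_eq_bot d p (cs.moved_one d),
    fun c hc => cs.modMoved_eq_top d p (cs.moved_coxeterElement d hc),
    fun c hc w hw h => cs.eq_one_of_moved_eq_bot d hc hw (hd.moved_eq_bot p h),
    fun c hc w hw h => cs.eq_of_moved_eq_top d hc hw (cs.moved_eq_top_of_modMoved_eq_top d p h),
    ?_, ?_, cs.modMoved_simple d p, ?_⟩
  · rintro g t _ ⟨α, hα, rfl⟩
    refine ⟨N g α, ?_, (hρ g α).symm⟩
    rw [hN]
    exact IsRootOf.geomRep cs d hα g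
  · rintro t _ _ ⟨α, hα, rfl⟩ ⟨β, hβ, rfl⟩
    rcases IsCrystallographic.eq_or_eq_neg_of_isRootOf cs hd hα hβ with h | h
    · exact Or.inl (by rw [intVec_injective h])
    · rw [← map_neg] at h
      exact Or.inr (by rw [intVec_injective h, map_neg])
  · intro i j hij hM
    obtain ⟨A, hA⟩ := hd.exists_cartan
    refine ⟨-(A i j : ZMod p), 1, neg_ne_zero.2 (hp.cartan_ne_zero hij hM (hA i j)), one_ne_zero,
      ?_⟩
    have h1 : N (cs.simple i) (Pi.single j 1) = Pi.single i (-A i j) + Pi.single j 1 := by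
      apply intVec_injective
      rw [hN, map_add, intVec_single, intVec_single, geomRep_simple_apply, Int.cast_one,
        ← simpleRoot, hA, sub_eq_neg_add, ← neg_smul, simpleRoot, ← Pi.single_smul, simpleRoot]
      simp
    have h2 := hρ (cs.simple i) (Pi.single j 1)
    rw [h1, map_add, reduceMod_single, reduceMod_single, Int.cast_neg, Int.cast_one] at h2
    rw [hconj, modMoved_simple, Submodule.map_span, Set.image_singleton, h2]
    rfl

end Reduction

end CoxeterSystem

theorem mainTheorem4 {B W : Type*} [Fintype B] [DecidableEq B] [Group W] [Finite W]
    {M : CoxeterMatrix B} (cs : CoxeterSystem M W) (c l r : W) (hc : cs.IsCoxeterElement c)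
    (h : CoxeterSystem.IsBipartition c l r) (φ : cs.NC c ≃o cs.NC c)
    (hφ : φ ∈ cs.dihedralAut h) :
    cs.ExtendsUniquely (fun w => cs.moved CoxeterSystem.unitLengths w.val)
      (cs.IsRootOf CoxeterSystem.unitLengths) φ ∧
    ∀ d : B → Set.Ioi (0 : ℝ), cs.IsCrystallographic d →
      ∀ p : ℕ, [Fact p.Prime] → cs.IsCompatible d p →
        cs.ExtendsUniquely (fun w => cs.modMoved d p w.val) (cs.IsModRootOf d p) φ := by
  refine ⟨cs.isMovedMap_moved.extendsUniquely hc h hφ, fun d hd p _ hp => ?_⟩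
  obtain ⟨ρ, hρ⟩ := hd.exists_isMovedMap hp
  exact hρ.extendsUniquely hc h hφ
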